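/- A function $\sigma:\mathbb{R}\to\mathbb{R}$ is called nearly exponential if for each $\varepsilon>0$ there are $a,b,c,d\in\mathbb{R}$ such that $|a\sigma(bx+c)+d-e^x|<\varepsilon$ for all $x\in(-\infty,0]$. For $n\in\mathbb{N}=\{1,2,\dots\}$ let $$\Phi_{n,\sigma}:=\Big\{g:[0,1]\to\mathbb{R} : g(x)=\sum_{k=1}^n a_k\sigma(b_kx+c_k),\ a_k,b_k,c_k\in\mathbb{R}\Big\}.$$ Let $X^p[0,1]:=L^p[0,1]$ with its usual norm for $1\le p<\infty$, and $X^\infty[0,1]:=C[0,1]$ with $\|f\|_{X^\infty[0,1]}:=\sup_{x\in[0,1]}|f(x)|$. For $f\in X^p[0,1]$ put $E(\Phi_{n,\sigma},f)_p:=\inf\{\|f-g\|_{X^p[0,1]} : g\in\Phi_{n,\sigma}\}$, where $\|f-g\|_{X^\infty[0,1]}$ is the supremum of $|f-g|$ on $[0,1]$ (possibly $\infty$) also if $g$ is not continuous, and, for $p<\infty$, $\|f-g\|_{X^p[0,1]}$ is formed with the upper integral (possibly $\infty$) if $g$ is not measurable. For $r\in\mathbb{N}$ and $\delta>0$ let $\Delta_h^rf(x):=\sum_{j=0}^r(-1)^{r-j}\binom{r}{j}f(x+jh)$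 and $$\omega_r(f,\delta)_p:=\sup_{0<h\le\delta}\Big(\int_0^{1-rh}|\Delta_h^rf(x)|^p\,dx\Big)^{1/p}\ (1\le p<\infty),\qquad \omega_r(f,\delta)_\infty:=\sup\{|\Delta_h^rf(x)| : 0<h\le\delta,\ x\in[0,1-rh]\},$$ where only step sizes with $rh\le 1$ count. Theorem. For each $r\in\mathbb{N}$ there is a constant $C_r$, depending only on $r$, such that for every nearly exponential $\sigma:\mathbb{R}\to\mathbb{R}$, every $1\le p\le\infty$, every $f\in X^p[0,1]$ and every $n\ge\max\{r,2\}$, $$E(\Phi_{n,\sigma},f)_p\le C_r\,\omega_r\Big(f,\frac1n\Big)_p.$$ -/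

import Mathlib

open MeasureTheory Set
open scoped ENNReal NNReal

/-- `σ` is nearly exponential: the functions `a σ(bx + c) + d` approximate `eˣ` arbitrarily well,
uniformly on `(-∞, 0]`. -/
def NearlyExponential (σ : ℝ → ℝ) : Prop :=
  ∀ ε : ℝ, 0 < ε → ∃ a b c d : ℝ, ∀ x : ℝ, x ≤ 0 → |a * σ (b * x + c) + d - Real.exp x| < ε

/-- The set of functions `x ↦ ∑ₖ aₖ σ(bₖ x + cₖ)` with `n` summands. They are considered on `[0, 1]`
only: every norm below that is applied to them ignores their values outside this interval. -/
def networks (n : ℕ) (σ : ℝ → ℝ) : Set (ℝ → ℝ) :=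
  {g | ∃ a b c : Fin n → ℝ, g = fun x => ∑ k, a k * σ (b k * x + c k)}

/-- Membership in `X^p[0, 1]`: continuity on `[0, 1]` for `p = ∞`, and `L^p[0, 1]` for `p < ∞`. -/
def MemX (p : ℝ≥0∞) (f : ℝ → ℝ) : Prop :=
  (p = ∞ → ContinuousOn f (Icc 0 1)) ∧ (p ≠ ∞ → MemLp f p (volume.restrict (Icc 0 1)))

open Classical in
/-- The `X^p` norm on the set `s`, with values in `[0, ∞]`: the true (not the essential) supremum
of `|u|` for `p = ∞`, and the `L^p` norm with respect to Lebesgue measure for `p < ∞`. In the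
latter case it is written as an upper integral (the infimum of the norms of the measurable
majorants of `|u|`), so that it has its proper meaning for functions `u` that are not measurable
too; for measurable `u` it is the usual norm, see `normOn_eq_eLpNorm`. -/
noncomputable def normOn (p : ℝ≥0∞) (s : Set ℝ) (u : ℝ → ℝ) : ℝ≥0∞ :=
  if p = ∞ then ⨆ x ∈ s, ‖u x‖ₑ
  else ⨅ (v : ℝ → ℝ≥0∞) (_ : Measurable v) (_ : ∀ᵐ x ∂volume.restrict s, ‖u x‖ₑ ≤ v x),
    eLpNorm v p (volume.restrict s)

theorem normOn_top (s : Set ℝ) (u : ℝ → ℝ) : normOn ∞ s u = ⨆ x ∈ s, ‖u x‖ₑ := by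
  simp [normOn]

theorem normOn_eq_eLpNorm {p : ℝ≥0∞} (hp : p ≠ ∞) (s : Set ℝ) (u : ℝ → ℝ)
    (hu : AEMeasurable u (volume.restrict s)) :
    normOn p s u = eLpNorm u p (volume.restrict s) := by
  rw [normOn, if_neg hp]
  apply le_antisymm
  · refine (iInf₂_le (fun x => ‖hu.mk u x‖ₑ) hu.measurable_mk.enorm).trans ?_
    refine (iInf_le _ ?_).trans ?_
    · filter_upwards [hu.ae_eq_mk] with x hx
      rw [hx]
    · refine (eLpNorm_mono_enorm_ae ?_)
      filter_upwards [hu.ae_eq_mk] with x hx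
      simp [hx]
  · refine le_iInf fun v => le_iInf fun _ => le_iInf fun hle => ?_
    exact eLpNorm_mono_enorm_ae (by simpa using hle)

/-- The error of best approximation of `f` by elements of `Φ` in the norm of `X^p[0, 1]`. -/
noncomputable def bestApproxError (Φ : Set (ℝ → ℝ)) (f : ℝ → ℝ) (p : ℝ≥0∞) : ℝ≥0∞ :=
  ⨅ g ∈ Φ, normOn p (Icc 0 1) (fun x => f x - g x)

/-- The `r`-th modulus of smoothness `ω_r(f, δ)_p` on `[0, 1]`: the supremum over `0 < h ≤ δ` of
the `X^p` norm on `[0, 1 - rh]` of the `r`-th forward difference of `f` with step size `h`. -/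
noncomputable def modulusOfSmoothness (r : ℕ) (f : ℝ → ℝ) (δ : ℝ) (p : ℝ≥0∞) : ℝ≥0∞ :=
  ⨆ h ∈ Ioc 0 δ, normOn p (Icc 0 (1 - r * h)) ((fwdDiff h)^[r] f)

/-!
The uniform closure of `networks n σ` on `[0, 1]` contains all polynomials of degree less than `n`:
`((e^{tx} - 1) / t)^k → x^k` as `t → 0`, so polynomials are limits of exponential sums
`∑ k < n, q_k e^{ktx}`. Each exponential with `k ≥ 1` is, up to a constant, close to one neuron, and
all the constants together are one more neuron with slope `0`
(`NearlyExponential.exists_network_near_polynomial`). It remains to prove the Jackson–Stechkin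
inequality for algebraic polynomials in `Lᵖ[0, 1]`, uniformly in `p` (`exists_polynomial_jackson`).

This has two halves. A smooth function is approximated by polynomials with error
`O(n⁻ᵏ ‖G⁽ᵏ⁾‖_p)` (`IsIteratedIntegral.exists_polynomial_approx`). By induction it is enough to treat
`k = 1`. There `G(x) = G(0) + ∫ G'(u) H(x - u) du` with the step function `H`, and replacing `H` by
a polynomial `S` gives a polynomial in `x`, with an error that Young's inequality bounds by
`‖G'‖_p ‖H - S‖_{L¹[-1, 1]}`. A suitable `S` is the normalized antiderivative of the Jackson-type
kernel `(T_m(x) / x)⁴` with `m` odd, whose first absolute moment is `O(1/m)` relative to its mass.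

In the second half (`exists_iteratedIntegral_approx`) a general `F` is replaced by a smooth function.
If `s` is distributed as a sum of `r` independent uniform variables and `h = τ (s - r x)`, then `x`
and `x + r h` stay in `[0, 1]`, so that the mean of `Δ_h^r F(x)` over `s` makes sense without an
extension of `F`. Its `Lᵖ` norm in `x` is controlled by the modulus of smoothness: the density of
`s` is at most `1`, hence one may pass from `s` to `h` and exchange the integrals
(`lintegral_variable_step_le`). The terms `F(x + j h)` with `j ≥ 1` have Steklov averages of order
`r` as their means, whose `r`-th derivatives are difference quotients of order `r` of `F`.
-/

/-! ### A polynomial close to the step function -/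

theorem abs_sin_nat_mul_le (m : ℕ) (φ : ℝ) : |Real.sin (m * φ)| ≤ m * |Real.sin φ| := by
  induction m with
  | zero => simp
  | succ k ih =>
    have h1 : ((k + 1 : ℕ) : ℝ) * φ = k * φ + φ := by push_cast; ring
    rw [h1, Real.sin_add]
    refine (abs_add_le _ _).trans ?_
    rw [abs_mul, abs_mul]
    have h2 := Real.abs_cos_le_one φ
    have h3 := Real.abs_cos_le_one (k * φ)
    have h4 := abs_nonneg (Real.sin φ)
    have h5 := abs_nonneg (Real.sin (k * φ))
    push_cast
    nlinarith

theorem abs_eval_T_odd_sin (q : ℕ) (φ : ℝ) :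
    |(Polynomial.Chebyshev.T ℝ (2 * q + 1)).eval (Real.sin φ)|
      = |Real.sin ((2 * q + 1 : ℕ) * φ)| := by
  rw [← Real.cos_pi_div_two_sub, Polynomial.Chebyshev.T_real_cos]
  have : (((2 * q + 1 : ℤ) : ℝ)) * (Real.pi / 2 - φ)
      = (Real.pi / 2 - (2 * q + 1 : ℕ) * φ) + q * Real.pi := by push_cast; ring
  rw [this, Real.cos_add_nat_mul_pi, Real.cos_pi_div_two_sub, abs_mul]
  simp

/-- The quotient `T_m(x) / x` for odd `m = 2q + 1`. It is of size at most `min(m, 1/|x|)` on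
`[-1, 1]`, and comparable to `m` for `|x| ≤ 1/m`. -/
theorem exists_chebyshev_quotient (q : ℕ) : ∃ D : Polynomial ℝ, D.natDegree ≤ 2 * q ∧
    (∀ x : ℝ, x ≠ 0 → |x| ≤ 1 → |D.eval x| ≤ (2 * q + 1 : ℕ) ∧ |x * D.eval x| ≤ 1) ∧
    (∀ x : ℝ, 0 < x → x ≤ 1 / (2 * q + 1 : ℕ) → ((2 * q + 1 : ℕ) : ℝ) / 2 ≤ |D.eval x|) := by
  set T := Polynomial.Chebyshev.T ℝ (2 * q + 1) with hT
  have h0 : T.IsRoot 0 := by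
    have := abs_eval_T_odd_sin q 0
    simpa [← hT] using this
  obtain ⟨D, hD⟩ := Polynomial.dvd_iff_isRoot.2 h0
  rw [Polynomial.C_0, sub_zero] at hD
  have hev : ∀ x : ℝ, x * D.eval x = T.eval x := fun x => by rw [hD]; simp
  have hdeg : T.natDegree = 2 * q + 1 := by
    rw [hT, Polynomial.Chebyshev.natDegree_T]; omega
  have hmul : ∀ x : ℝ, |x| * |D.eval x| = |T.eval x| := fun x => by rw [← hev, abs_mul]
  refine ⟨D, ?_, ?_, ?_⟩
  · have hne : D ≠ 0 := by
      rintro rfl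
      simp [hD] at hdeg
    rw [hD, Polynomial.natDegree_X_mul hne] at hdeg
    omega
  · intro x hx hx1
    have hx' := abs_le.1 hx1
    have hsin := Real.sin_arcsin hx'.1 hx'.2
    constructor
    · have h1 := abs_sin_nat_mul_le (2 * q + 1) (Real.arcsin x)
      rw [← abs_eval_T_odd_sin, hsin, ← hT, ← hmul, mul_comm] at h1
      exact le_of_mul_le_mul_right h1 (abs_pos.2 hx)
    · rw [hev]
      exact Polynomial.Chebyshev.abs_eval_T_real_le_one _ hx1
  · intro x hx hxm
    set m : ℕ := 2 * q + 1 with hm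
    have hm1 : (1 : ℝ) ≤ m := by rw [hm]; push_cast; linarith [(Nat.cast_nonneg q : (0:ℝ) ≤ q)]
    have hx1 : x ≤ 1 := hxm.trans (by rw [div_le_one (by linarith)]; exact hm1)
    have hsin := Real.sin_arcsin (by linarith : -1 ≤ x) hx1
    set φ := Real.arcsin x with hφ
    have hφ0 : 0 ≤ φ := Real.arcsin_nonneg.2 hx.le
    have hφ1 : φ ≤ Real.pi / 2 := Real.arcsin_le_pi_div_two x
    have h1 : x ≤ φ := by rw [← hsin]; exact Real.sin_le hφ0
    have h2 := Real.mul_le_sin hφ0 hφ1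
    have hpi := Real.pi_pos
    have h3 : m * φ ≤ Real.pi / 2 := by
      rw [hsin, div_mul_eq_mul_div, div_le_iff₀ hpi] at h2
      have h5 : x * m ≤ 1 := by rwa [le_div_iff₀ (by linarith)] at hxm
      nlinarith
    have h4 := Real.mul_le_sin (by positivity : 0 ≤ m * φ) h3
    have h6 := abs_eval_T_odd_sin q φ
    rw [hsin, ← hT, ← hmul, abs_of_pos hx, ← hm] at h6
    have h7 : 1 / 2 ≤ 2 / Real.pi := by
      rw [div_le_div_iff₀ two_pos hpi]; linarith [Real.pi_le_four]
    have h8 : x * (m / 2) ≤ x * |D.eval x| := by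
      rw [h6]
      refine le_trans ?_ (h4.trans (le_abs_self _))
      calc x * (m / 2) = 1 / 2 * (m * x) := by ring
        _ ≤ 2 / Real.pi * (m * φ) := by gcongr
    exact le_of_mul_le_mul_left h8 hx

/-- The polynomial kernel `(T_m(x) / x)⁴` for odd `m`, a Jackson-type kernel concentrated on
`|x| ≲ 1/m`. -/
theorem exists_jackson_kernel (q : ℕ) : ∃ K : Polynomial ℝ, K.natDegree ≤ 8 * q ∧
    (∀ x : ℝ, 0 ≤ K.eval x) ∧
    (∀ x : ℝ, x ≠ 0 → |x| ≤ 1 →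
      K.eval x ≤ 4 * ((2 * q + 1 : ℕ) : ℝ) ^ 4 / (1 + ((2 * q + 1 : ℕ) : ℝ) ^ 2 * x ^ 2) ^ 2) ∧
    (∀ x : ℝ, 0 < x → x ≤ 1 / (2 * q + 1 : ℕ) → ((2 * q + 1 : ℕ) : ℝ) ^ 4 / 16 ≤ K.eval x) := by
  obtain ⟨D, hdeg, hup, hlow⟩ := exists_chebyshev_quotient q
  refine ⟨D ^ 4, ?_, ?_, ?_, ?_⟩
  · refine Polynomial.natDegree_pow_le.trans ?_
    omega
  · intro x
    rw [Polynomial.eval_pow]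
    positivity
  · intro x hx hx1
    obtain ⟨h1, h2⟩ := hup x hx hx1
    set m : ℝ := ((2 * q + 1 : ℕ) : ℝ)
    set d := D.eval x
    rw [Polynomial.eval_pow, le_div_iff₀ (by positivity)]
    have h1' : d ^ 2 ≤ m ^ 2 := by rw [← sq_abs d]; gcongr
    have h2' : (x * d) ^ 2 ≤ 1 := by rw [← sq_abs]; exact pow_le_one₀ (abs_nonneg _) h2
    have h3 : d ^ 2 * (1 + m ^ 2 * x ^ 2) ≤ 2 * m ^ 2 := by nlinarith [sq_nonneg m]
    calc d ^ 4 * (1 + m ^ 2 * x ^ 2) ^ 2 = (d ^ 2 * (1 + m ^ 2 * x ^ 2)) ^ 2 := by ring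
      _ ≤ (2 * m ^ 2) ^ 2 := by gcongr
      _ = 4 * m ^ 4 := by ring
  · intro x hx hxm
    have h := hlow x hx hxm
    rw [Polynomial.eval_pow]
    calc _ = (((2 * q + 1 : ℕ) : ℝ) / 2) ^ 4 := by ring
      _ ≤ |D.eval x| ^ 4 := by gcongr
      _ = D.eval x ^ 4 := by rw [Even.pow_abs (by decide)]

theorem exists_polynomial_antiderivative (K : Polynomial ℝ) :
    ∃ A : Polynomial ℝ, A.derivative = K ∧ A.natDegree ≤ K.natDegree + 1 := by
  refine ⟨∑ i ∈ Finset.range (K.natDegree + 1),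
    Polynomial.monomial (i + 1) (K.coeff i / (i + 1)), ?_, ?_⟩
  · rw [Polynomial.derivative_sum]
    conv_rhs => rw [K.as_sum_range]
    refine Finset.sum_congr rfl fun i _ => ?_
    rw [Polynomial.derivative_monomial]
    congr 1
    push_cast
    field_simp
  · refine Polynomial.natDegree_sum_le_of_forall_le _ _ fun i hi => ?_
    refine (Polynomial.natDegree_monomial_le _).trans ?_
    have := Finset.mem_range.1 hi
    omega

theorem integral_eval_derivative (A : Polynomial ℝ) (a b : ℝ) :
    ∫ y in a..b, A.derivative.eval y = A.eval b - A.eval a :=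
  intervalIntegral.integral_eq_sub_of_hasDerivAt (fun x _ => A.hasDerivAt x)
    (A.derivative.continuous.intervalIntegrable _ _)

theorem integral_eval_by_parts (A : Polynomial ℝ) (a b : ℝ) :
    ∫ y in a..b, A.eval y
      = b * A.eval b - a * A.eval a - ∫ y in a..b, y * A.derivative.eval y := by
  have h := integral_eval_derivative (Polynomial.X * A) a b
  simp only [Polynomial.derivative_mul, Polynomial.derivative_X, one_mul, Polynomial.eval_add,
    Polynomial.eval_mul, Polynomial.eval_X] at h
  rw [intervalIntegral.integral_add (A.continuous.intervalIntegrable _ _)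
    (Continuous.intervalIntegrable (by have := A.derivative.continuous; fun_prop) _ _)] at h
  linarith

theorem integral_rational_weight_le (m : ℝ) (hm : 0 < m) :
    ∫ y in (0 : ℝ)..1, y * (4 * m ^ 4 / (1 + m ^ 2 * y ^ 2) ^ 2) ≤ 2 * m ^ 2 := by
  have hpos : ∀ y : ℝ, 0 < 1 + m ^ 2 * y ^ 2 := fun y => by positivity
  have hder : ∀ y : ℝ, HasDerivAt (fun y : ℝ => -(2 * m ^ 2) * (1 + m ^ 2 * y ^ 2)⁻¹)
      (y * (4 * m ^ 4 / (1 + m ^ 2 * y ^ 2) ^ 2)) y := by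
    intro y
    have h1 : HasDerivAt (fun y : ℝ => 1 + m ^ 2 * y ^ 2) (m ^ 2 * (2 * y)) y := by
      simpa using ((hasDerivAt_pow 2 y).const_mul (m ^ 2)).const_add 1
    convert! (h1.inv (hpos y).ne').const_mul (-(2 * m ^ 2)) using 1
    field_simp
    ring
  rw [intervalIntegral.integral_eq_sub_of_hasDerivAt (fun y _ => hder y)]
  · have := inv_pos.2 (hpos 1)
    simp only [ne_eq, OfNat.ofNat_ne_zero, not_false_eq_true, zero_pow, mul_zero, add_zero, inv_one]
    nlinarith [sq_nonneg m, mul_pos (pow_pos hm 2) this]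
  · refine Continuous.intervalIntegrable ?_ _ _
    refine continuous_id.mul (continuous_const.div (by fun_prop) fun y => ?_)
    exact (pow_pos (hpos y) 2).ne'

/-- The normalized antiderivative `S` of the kernel is close to the step function in `L¹[-1, 1]`:
integration by parts turns the error into the first absolute moment of the kernel. -/
theorem exists_step_polynomial_of_kernel (q : ℕ) : ∃ S : Polynomial ℝ, S.natDegree ≤ 8 * q + 1 ∧
    (∫ y in (-1 : ℝ)..0, |S.eval y|) + (∫ y in (0 : ℝ)..1, |1 - S.eval y|)
      ≤ 64 / ((2 * q + 1 : ℕ) : ℝ) := by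
  obtain ⟨K, hdeg, hK0, hKup, hKlow⟩ := exists_jackson_kernel q
  set m : ℝ := ((2 * q + 1 : ℕ) : ℝ) with hm
  have hm1 : 1 ≤ m := by rw [hm]; push_cast; linarith [(Nat.cast_nonneg q : (0:ℝ) ≤ q)]
  have hm0 : 0 < m := by linarith
  obtain ⟨A, hA, hAdeg⟩ := exists_polynomial_antiderivative K
  have hmono : Monotone fun x => A.eval x :=
    monotone_of_deriv_nonneg A.differentiable fun x => by
      rw [Polynomial.deriv, hA]; exact hK0 x
  have hκ : m ^ 3 / 16 ≤ A.eval 1 - A.eval (-1) := by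
    have h1 : m ^ 3 / 16 ≤ ∫ y in (0 : ℝ)..(1 / m), K.eval y := by
      calc m ^ 3 / 16 = ∫ y in (0 : ℝ)..(1 / m), m ^ 4 / 16 := by
            rw [intervalIntegral.integral_const, smul_eq_mul]; field_simp; ring
        _ ≤ _ := by
          refine intervalIntegral.integral_mono_on_of_le_Ioo (by positivity)
            intervalIntegrable_const (K.continuous.intervalIntegrable _ _) fun x hx => ?_
          exact hKlow x hx.1 hx.2.le
    rw [← hA, integral_eval_derivative] at h1
    have h2 : A.eval (1 / m) ≤ A.eval 1 := hmono (by rw [div_le_one hm0]; exact hm1)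
    have h3 : A.eval (-1) ≤ A.eval 0 := hmono (by norm_num)
    linarith
  set κ := A.eval 1 - A.eval (-1) with hκdef
  have hκ0 : 0 < κ := lt_of_lt_of_le (by positivity) hκ
  have hR : ∫ y in (0 : ℝ)..1, y * K.eval y ≤ 2 * m ^ 2 := by
    refine le_trans ?_ (integral_rational_weight_le m hm0)
    refine intervalIntegral.integral_mono_on_of_le_Ioo zero_le_one
      ((continuous_id.mul K.continuous).intervalIntegrable _ _)
      (Continuous.intervalIntegrable ?_ _ _) fun x hx => ?_
    · refine continuous_id.mul (continuous_const.div (by fun_prop) fun y => ?_)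
      positivity
    · exact mul_le_mul_of_nonneg_left
        (hKup x hx.1.ne' (by rw [abs_of_pos hx.1]; exact hx.2.le)) hx.1.le
  have hL : ∫ y in (-1 : ℝ)..0, -(y * K.eval y) ≤ 2 * m ^ 2 := by
    refine le_trans ?_ (integral_rational_weight_le m hm0)
    have h := intervalIntegral.integral_comp_neg (a := 0) (b := 1)
      (fun y : ℝ => -(y * K.eval y))
    rw [neg_zero] at h
    rw [← h]
    refine intervalIntegral.integral_mono_on_of_le_Ioo zero_le_one
      (Continuous.intervalIntegrable ?_ _ _)
      (Continuous.intervalIntegrable ?_ _ _) fun x hx => ?_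
    · have := K.continuous
      fun_prop
    · refine continuous_id.mul (continuous_const.div (by fun_prop) fun y => ?_)
      positivity
    · have h1 := hKup (-x) (neg_ne_zero.2 hx.1.ne') (by rw [abs_neg, abs_of_pos hx.1]; exact hx.2.le)
      rw [neg_sq] at h1
      rw [neg_mul, neg_neg]
      exact mul_le_mul_of_nonneg_left h1 hx.1.le
  set S := Polynomial.C κ⁻¹ * (A - Polynomial.C (A.eval (-1))) with hS
  have hSev : ∀ y, S.eval y = κ⁻¹ * (A.eval y - A.eval (-1)) := fun y => by simp [hS]
  have hS' : S.derivative = Polynomial.C κ⁻¹ * K := by simp [hS, hA]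
  have hS1 : S.eval 1 = 1 := by rw [hSev]; exact inv_mul_cancel₀ hκ0.ne'
  have hS0 : S.eval (-1) = 0 := by rw [hSev]; simp
  have hSmono : Monotone fun x => S.eval x := fun x y hxy => by
    simp only [hSev]
    have := hmono hxy
    simp only at this
    gcongr
  refine ⟨S, ?_, ?_⟩
  · refine (Polynomial.natDegree_C_mul_le _ _).trans ?_
    rw [Polynomial.natDegree_sub_C]
    omega
  have e1 : ∫ y in (-1 : ℝ)..0, |S.eval y| = κ⁻¹ * ∫ y in (-1 : ℝ)..0, -(y * K.eval y) := by
    have : ∫ y in (-1 : ℝ)..0, |S.eval y| = ∫ y in (-1 : ℝ)..0, S.eval y := by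
      refine intervalIntegral.integral_congr fun y hy => ?_
      rw [uIcc_of_le (by norm_num)] at hy
      refine abs_of_nonneg ?_
      rw [← hS0]; exact hSmono hy.1
    rw [this, integral_eval_by_parts, hS0, hS', ← intervalIntegral.integral_const_mul,
      zero_mul, mul_zero, sub_zero, zero_sub, ← intervalIntegral.integral_neg]
    refine intervalIntegral.integral_congr fun y _ => ?_
    simp only [Polynomial.eval_mul, Polynomial.eval_C]
    ring
  have e2 : ∫ y in (0 : ℝ)..1, |1 - S.eval y| = κ⁻¹ * ∫ y in (0 : ℝ)..1, y * K.eval y := by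
    have : ∫ y in (0 : ℝ)..1, |1 - S.eval y| = ∫ y in (0 : ℝ)..1, (1 - S).eval y := by
      refine intervalIntegral.integral_congr fun y hy => ?_
      rw [uIcc_of_le zero_le_one] at hy
      simp only [Polynomial.eval_sub, Polynomial.eval_one]
      refine abs_of_nonneg (sub_nonneg.2 ?_)
      rw [← hS1]; exact hSmono hy.2
    rw [this, integral_eval_by_parts]
    simp only [Polynomial.eval_sub, Polynomial.eval_one, hS1, Polynomial.derivative_sub,
      Polynomial.derivative_one, hS', sub_self, mul_zero, zero_mul, zero_sub]
    rw [← intervalIntegral.integral_const_mul, ← intervalIntegral.integral_neg]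
    refine intervalIntegral.integral_congr fun y _ => ?_
    simp only [Polynomial.eval_mul, Polynomial.eval_C, Polynomial.eval_neg]
    ring
  rw [e1, e2, ← mul_add]
  calc κ⁻¹ * _ ≤ κ⁻¹ * (4 * m ^ 2) := by gcongr; linarith
    _ ≤ (m ^ 3 / 16)⁻¹ * (4 * m ^ 2) := by gcongr
    _ = 64 / m := by field_simp; norm_num

/-- A polynomial of degree less than `n` approximates the step function in `L¹[-1, 1]` to within
`O(1/n)`. -/
theorem exists_step_polynomial (n : ℕ) (hn : 1 ≤ n) : ∃ S : Polynomial ℝ, S.natDegree < n ∧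
    ∫⁻ y in Icc (-1 : ℝ) 1, ‖(if 0 < y then 1 else 0) - S.eval y‖ₑ
      ≤ ENNReal.ofReal (1024 / n) := by
  have key : ∀ S : Polynomial ℝ,
      ∫⁻ y in Icc (-1 : ℝ) 1, ‖(if 0 < y then 1 else 0) - S.eval y‖ₑ
        = ENNReal.ofReal ((∫ y in (-1 : ℝ)..0, |S.eval y|)
            + (∫ y in (0 : ℝ)..1, |1 - S.eval y|)) := by
    intro S
    have hc := S.continuous
    have hi1 : IntegrableOn (fun y => S.eval y) (Ioc (-1) 0) :=
      (hc.integrableOn_Icc).mono_set Ioc_subset_Icc_self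
    have hi2 : IntegrableOn (fun y => 1 - S.eval y) (Ioc 0 1) :=
      ((continuous_const.sub hc).integrableOn_Icc).mono_set Ioc_subset_Icc_self
    rw [intervalIntegral.integral_of_le (by norm_num), intervalIntegral.integral_of_le zero_le_one,
      ENNReal.ofReal_add (integral_nonneg fun _ => abs_nonneg _)
        (integral_nonneg fun _ => abs_nonneg _)]
    simp only [← Real.norm_eq_abs]
    rw [ofReal_integral_norm_eq_lintegral_enorm hi1, ofReal_integral_norm_eq_lintegral_enorm hi2,
      setLIntegral_congr Ioc_ae_eq_Icc.symm,
      ← Ioc_union_Ioc_eq_Ioc (by norm_num : (-1 : ℝ) ≤ 0) zero_le_one,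
      lintegral_union measurableSet_Ioc (Ioc_disjoint_Ioc_of_le le_rfl)]
    congr 1
    · refine setLIntegral_congr_fun measurableSet_Ioc fun y hy => ?_
      simp [not_lt.2 hy.2]
    · refine setLIntegral_congr_fun measurableSet_Ioc fun y hy => ?_
      simp [hy.1]
  have hn0 : (0 : ℝ) < n := by exact_mod_cast hn
  rcases Nat.lt_or_ge n 2 with h2 | h2
  · obtain rfl : n = 1 := by omega
    refine ⟨0, by simp, ?_⟩
    rw [key]
    refine ENNReal.ofReal_le_ofReal ?_
    simp
  · obtain ⟨S, hdeg, hS⟩ := exists_step_polynomial_of_kernel ((n - 2) / 8)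
    refine ⟨S, by omega, ?_⟩
    rw [key]
    refine ENNReal.ofReal_le_ofReal (hS.trans ?_)
    -- `8 * ((n - 2) / 8) + 1 ≤ n - 1` bounds the degree, and `m ≥ n / 16` bounds the error
    have h3 : n ≤ 16 * (2 * ((n - 2) / 8) + 1) := by omega
    have h4 : (n : ℝ) ≤ 16 * ((2 * ((n - 2) / 8) + 1 : ℕ) : ℝ) := by exact_mod_cast h3
    rw [div_le_div_iff₀ (by positivity) hn0]
    linarith

/-! ### Minkowski's and Young's inequalities -/

/-- Jensen's inequality for a finite measure, with `ℝ≥0∞`-valued functions. -/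
theorem lintegral_rpow_le_measure_univ_mul {Y : Type*} [MeasurableSpace Y] (ν : Measure Y)
    [IsFiniteMeasure ν] {q : ℝ} (hq : 1 ≤ q) {A : Y → ℝ≥0∞} (hA : Measurable A) :
    (∫⁻ t, A t ∂ν) ^ q ≤ ν univ ^ (q - 1) * ∫⁻ t, A t ^ q ∂ν := by
  have hq0 : 0 < q := by linarith
  have h := eLpNorm_le_eLpNorm_mul_rpow_measure_univ (μ := ν) (p := 1) (q := ENNReal.ofReal q)
    (f := A) (by simpa using hq) hA.aestronglyMeasurable
  rw [eLpNorm_one_eq_lintegral_enorm, eLpNorm_eq_lintegral_rpow_enorm_toReal (by simpa using hq0)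
    ENNReal.ofReal_ne_top, ENNReal.toReal_ofReal hq0.le] at h
  simp only [enorm_eq_self, ENNReal.toReal_one, one_div, inv_one] at h
  calc (∫⁻ t, A t ∂ν) ^ q ≤ ((∫⁻ t, A t ^ q ∂ν) ^ q⁻¹ * ν univ ^ (1 - q⁻¹)) ^ q := by gcongr
    _ = _ := by
      rw [ENNReal.mul_rpow_of_nonneg _ _ hq0.le, ← ENNReal.rpow_mul, ← ENNReal.rpow_mul,
        inv_mul_cancel₀ hq0.ne', ENNReal.rpow_one, sub_mul, one_mul, inv_mul_cancel₀ hq0.ne',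
        mul_comm]

/-- A form of Minkowski's integral inequality: if the `p`-th power of `A` has mean at most `B ^ p`
with respect to the parameter `t`, then the integral over `t` has `Lᵖ` norm at most `ν(Y) * B`. -/
theorem eLpNorm_lintegral_le {X Y : Type*} [MeasurableSpace X] [MeasurableSpace Y]
    (μ : Measure X) (ν : Measure Y) [IsFiniteMeasure ν] {p : ℝ≥0∞} (hp : 1 ≤ p)
    {A : X → Y → ℝ≥0∞} (hA : Measurable (Function.uncurry A)) (B : ℝ≥0∞)
    (hfin : p ≠ ∞ → ∫⁻ x, ∫⁻ t, A x t ^ p.toReal ∂ν ∂μ ≤ ν univ * B ^ p.toReal)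
    (htop : p = ∞ → ∀ᵐ x ∂μ, ∀ᵐ t ∂ν, A x t ≤ B) :
    eLpNorm (fun x => ∫⁻ t, A x t ∂ν) p μ ≤ ν univ * B := by
  rcases eq_or_ne p ∞ with rfl | hpt
  · rw [eLpNorm_exponent_top]
    refine eLpNormEssSup_le_of_ae_enorm_bound ?_
    filter_upwards [htop rfl] with x hx
    rw [enorm_eq_self]
    calc ∫⁻ t, A x t ∂ν ≤ ∫⁻ _, B ∂ν := lintegral_mono_ae hx
      _ = ν univ * B := by rw [lintegral_const, mul_comm]
  · have hp0 : p ≠ 0 := (zero_lt_one.trans_le hp).ne'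
    set q := p.toReal with hq
    have hq1 : 1 ≤ q := by
      rw [hq, ← ENNReal.toReal_one]
      exact ENNReal.toReal_mono hpt hp
    have hq0 : 0 < q := by linarith
    rw [eLpNorm_eq_lintegral_rpow_enorm_toReal hp0 hpt, ← hq]
    simp only [enorm_eq_self]
    rw [one_div, ENNReal.rpow_inv_le_iff hq0]
    calc ∫⁻ x, (∫⁻ t, A x t ∂ν) ^ q ∂μ
        ≤ ∫⁻ x, ν univ ^ (q - 1) * ∫⁻ t, A x t ^ q ∂ν ∂μ := by
          refine lintegral_mono fun x => ?_
          exact lintegral_rpow_le_measure_univ_mul ν hq1 (hA.comp measurable_prodMk_left)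
      _ = ν univ ^ (q - 1) * ∫⁻ x, ∫⁻ t, A x t ^ q ∂ν ∂μ := by
          refine lintegral_const_mul _ ?_
          exact Measurable.lintegral_prod_right' (f := fun z : X × Y => A z.1 z.2 ^ q)
            (hA.pow_const q)
      _ ≤ ν univ ^ (q - 1) * (ν univ ^ (1 : ℝ) * B ^ q) := by
          rw [ENNReal.rpow_one]
          gcongr
          exact hfin hpt
      _ = (ν univ * B) ^ q := by
          rw [← mul_assoc, ← ENNReal.rpow_add_of_nonneg _ _ (by linarith) zero_le_one,
            sub_add_cancel, ENNReal.mul_rpow_of_nonneg _ _ hq0.le]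

/-- Young's inequality for the convolution of an `L¹` function with an `Lᵖ` function. -/
theorem eLpNorm_lconvolution_le {p : ℝ≥0∞} (hp : 1 ≤ p) {a k : ℝ → ℝ≥0∞} (ha : Measurable a)
    (hk : Measurable k) (hfin : ∫⁻ t, k t ≠ ∞) :
    eLpNorm (fun x => ∫⁻ t, k t * a (x - t)) p volume ≤ (∫⁻ t, k t) * eLpNorm a p volume := by
  have : IsFiniteMeasure (volume.withDensity k) := isFiniteMeasure_withDensity hfin
  have hA : Measurable (Function.uncurry fun x t : ℝ => a (x - t)) :=
    ha.comp (measurable_fst.sub measurable_snd)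
  have h := eLpNorm_lintegral_le volume (volume.withDensity k) hp hA (eLpNorm a p volume) ?_ ?_
  · rw [withDensity_apply _ MeasurableSet.univ, Measure.restrict_univ] at h
    convert! h using 2
    funext x
    exact (lintegral_withDensity_eq_lintegral_mul _ hk
      (ha.comp (measurable_const.sub measurable_id))).symm
  · intro hpt
    have hp0 : p ≠ 0 := (zero_lt_one.trans_le hp).ne'
    rw [lintegral_lintegral_swap (hA.pow_const _).aemeasurable]
    have : ∀ t : ℝ, ∫⁻ x, a (x - t) ^ p.toReal = eLpNorm a p volume ^ p.toReal := by
      intro t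
      rw [lintegral_sub_right_eq_self (fun x => a x ^ p.toReal) t,
        eLpNorm_eq_lintegral_rpow_enorm_toReal hp0 hpt]
      simp only [enorm_eq_self]
      rw [one_div, ENNReal.rpow_inv_rpow (ENNReal.toReal_pos hp0 hpt).ne']
    simp only [this, lintegral_const]
    rw [mul_comm]
  · rintro rfl
    refine (Measure.ae_ae_comm ?_).2 (ae_of_all _ fun t => ?_)
    · exact measurableSet_le hA measurable_const
    · have h1 : ∀ᵐ x, a x ≤ eLpNorm a ∞ volume := by
        rw [eLpNorm_exponent_top]
        simpa using enorm_ae_le_eLpNormEssSup a volume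
      exact (measurePreserving_sub_right volume t).quasiMeasurePreserving.ae h1

/-! ### Polynomial approximation of iterated integrals -/

/-- Convolving an integrable function with a polynomial gives a polynomial of the same degree. -/
theorem exists_polynomial_eq_convolution (S : Polynomial ℝ) {n : ℕ} (hS : S.natDegree < n)
    {χ : ℝ → ℝ} (hχ : IntegrableOn χ (Icc 0 1)) : ∃ P : Polynomial ℝ, P.degree < n ∧
      ∀ x, P.eval x = ∫ u in Icc (0 : ℝ) 1, χ u * S.eval (x - u) := by
  refine ⟨∑ i ∈ Finset.range n, Polynomial.monomial i
    (∫ u in Icc (0 : ℝ) 1, χ u * (Polynomial.hasseDeriv i S).eval (-u)), ?_, fun x => ?_⟩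
  · rw [← Polynomial.mem_degreeLT]
    refine Submodule.sum_mem _ fun i hi => Polynomial.mem_degreeLT.2 ?_
    exact (Polynomial.degree_monomial_le _ _).trans_lt (by exact_mod_cast Finset.mem_range.1 hi)
  · rw [Polynomial.eval_finsetSum]
    have h : ∀ u, χ u * S.eval (x - u)
        = ∑ i ∈ Finset.range n, χ u * (Polynomial.hasseDeriv i S).eval (-u) * x ^ i := by
      intro u
      rw [sub_eq_add_neg, ← Polynomial.taylor_eval,
        Polynomial.eval_eq_sum_range' (by rwa [Polynomial.natDegree_taylor]), Finset.mul_sum]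
      refine Finset.sum_congr rfl fun i _ => ?_
      rw [Polynomial.taylor_coeff, mul_assoc]
    simp only [h]
    rw [integral_finsetSum]
    · refine Finset.sum_congr rfl fun i _ => ?_
      rw [Polynomial.eval_monomial, integral_mul_const]
    · intro i _
      refine Integrable.mul_const ?_ _
      exact hχ.mul_continuousOn
        ((Polynomial.continuous _).comp continuous_neg).continuousOn isCompact_Icc

/-- Jackson's inequality for functions with a derivative `χ` in `Lᵖ`. -/
theorem exists_polynomial_approx_primitive {p : ℝ≥0∞} (hp : 1 ≤ p) {n : ℕ} (hn : 1 ≤ n)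
    {χ : ℝ → ℝ} (hχ : IntegrableOn χ (Icc 0 1)) : ∃ P : Polynomial ℝ, P.degree < n ∧
      eLpNorm (fun x => (∫ u in (0 : ℝ)..x, χ u) - P.eval x) p (volume.restrict (Icc 0 1))
        ≤ ENNReal.ofReal (1024 / n) * eLpNorm χ p (volume.restrict (Icc 0 1)) := by
  obtain ⟨S, hdeg, hS⟩ := exists_step_polynomial n hn
  obtain ⟨P, hPdeg, hP⟩ := exists_polynomial_eq_convolution S hdeg hχ
  refine ⟨P, hPdeg, ?_⟩
  have hDm : Measurable fun y : ℝ => (if 0 < y then (1 : ℝ) else 0) - S.eval y :=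
    (Measurable.ite measurableSet_Ioi measurable_const measurable_const).sub S.continuous.measurable
  set D : ℝ → ℝ := fun y => (if 0 < y then (1 : ℝ) else 0) - S.eval y with hD
  set k : ℝ → ℝ≥0∞ := (Icc (-1) 1).indicator fun y => ‖D y‖ₑ with hk
  have hkm : Measurable k := hDm.enorm.indicator measurableSet_Icc
  have hkint : ∫⁻ t, k t ≤ ENNReal.ofReal (1024 / n) := by
    rw [hk, lintegral_indicator measurableSet_Icc]; exact hS
  set a : ℝ → ℝ≥0∞ := (Icc 0 1).indicator fun u => ‖hχ.1.mk χ u‖ₑ with ha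
  have ham : Measurable a :=
    hχ.1.stronglyMeasurable_mk.measurable.enorm.indicator measurableSet_Icc
  have hpt : ∀ x ∈ Icc (0 : ℝ) 1,
      ‖(∫ u in (0 : ℝ)..x, χ u) - P.eval x‖ₑ ≤ ∫⁻ t, k t * a (x - t) := by
    intro x hx
    have e1 : ∫ u in (0 : ℝ)..x, χ u
        = ∫ u in Icc (0 : ℝ) 1, χ u * (if 0 < x - u then 1 else 0) := by
      rw [intervalIntegral.integral_of_le hx.1, integral_Ioc_eq_integral_Ioo,
        ← integral_Ico_eq_integral_Ioo]
      have : ∀ u, χ u * (if 0 < x - u then 1 else 0) = (Iio x).indicator χ u := by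
        intro u
        by_cases hu : u < x
        · simp [hu]
        · simp [hu]
      simp only [this]
      rw [setIntegral_indicator measurableSet_Iio]
      congr 2
      ext u
      simp only [mem_Ico, mem_inter_iff, mem_Icc, mem_Iio]
      constructor
      · rintro ⟨h1, h2⟩; exact ⟨⟨h1, h2.le.trans hx.2⟩, h2⟩
      · rintro ⟨⟨h1, _⟩, h2⟩; exact ⟨h1, h2⟩
    have i1 : IntegrableOn (fun u => χ u * (if 0 < x - u then 1 else 0)) (Icc 0 1) := by
      refine Integrable.mul_bdd (c := 1) hχ ?_ ?_
      · exact (Measurable.ite (measurableSet_lt measurable_const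
          (measurable_const.sub measurable_id)) measurable_const
          measurable_const).aestronglyMeasurable
      · refine ae_of_all _ fun u => ?_
        split_ifs <;> simp
    have i2 : IntegrableOn (fun u => χ u * S.eval (x - u)) (Icc 0 1) :=
      hχ.mul_continuousOn
        (S.continuous.comp (continuous_const.sub continuous_id)).continuousOn isCompact_Icc
    rw [hP, e1, ← integral_sub i1 i2]
    refine (enorm_integral_le_lintegral_enorm _).trans ?_
    rw [← lintegral_sub_left_eq_self (fun t => k t * a (x - t)) x,
      ← lintegral_indicator measurableSet_Icc]
    have hmk : ∀ᵐ u, u ∈ Icc (0 : ℝ) 1 → χ u = hχ.1.mk χ u :=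
      (ae_restrict_iff' measurableSet_Icc).1 hχ.1.ae_eq_mk
    refine lintegral_mono_ae ?_
    filter_upwards [hmk] with u hu
    by_cases hu1 : u ∈ Icc (0 : ℝ) 1
    · rw [indicator_of_mem hu1, ← mul_sub, enorm_mul, hk, indicator_of_mem, ha, sub_sub_cancel,
        indicator_of_mem hu1, mul_comm, hu hu1]
      exact ⟨by linarith [hx.1, hu1.2], by linarith [hx.2, hu1.1]⟩
    · rw [indicator_of_notMem hu1]
      exact zero_le
  calc eLpNorm (fun x => (∫ u in (0 : ℝ)..x, χ u) - P.eval x) p (volume.restrict (Icc 0 1))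
      ≤ eLpNorm (fun x => ∫⁻ t, k t * a (x - t)) p (volume.restrict (Icc 0 1)) := by
        refine eLpNorm_mono_enorm_ae ?_
        refine (ae_restrict_iff' measurableSet_Icc).2 (ae_of_all _ fun x hx => ?_)
        simpa using hpt x hx
    _ ≤ eLpNorm (fun x => ∫⁻ t, k t * a (x - t)) p volume :=
        eLpNorm_mono_measure _ Measure.restrict_le_self
    _ ≤ (∫⁻ t, k t) * eLpNorm a p volume :=
        eLpNorm_lconvolution_le hp ham hkm (hkint.trans_lt ENNReal.ofReal_lt_top).ne
    _ ≤ ENNReal.ofReal (1024 / n) * eLpNorm χ p (volume.restrict (Icc 0 1)) := by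
        gcongr
        rw [ha, eLpNorm_indicator_eq_eLpNorm_restrict measurableSet_Icc]
        refine le_of_eq (eLpNorm_congr_enorm_ae ?_)
        filter_upwards [hχ.1.ae_eq_mk] with u hu
        rw [enorm_eq_self, hu]

theorem intervalIntegrable_of_locallyIntegrable {ψ : ℝ → ℝ} (hψ : LocallyIntegrable ψ) (a b : ℝ) :
    IntervalIntegrable ψ volume a b :=
  (hψ.integrableOn_isCompact isCompact_uIcc).intervalIntegrable

/-- `G` is a `k`-fold integral of the integrable function `φ`: this encodes `G⁽ᵏ⁾ = φ`
without derivatives, with an arbitrary constant of integration at each step. -/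
def IsIteratedIntegral : ℕ → (ℝ → ℝ) → (ℝ → ℝ) → Prop
  | 0, φ, G => G = φ ∧ Integrable φ
  | k + 1, φ, G => ∃ ψ c, IsIteratedIntegral k φ ψ ∧ ∀ x, G x = c + ∫ y in (0 : ℝ)..x, ψ y

namespace IsIteratedIntegral

theorem locallyIntegrable {k : ℕ} {φ G : ℝ → ℝ} (h : IsIteratedIntegral k φ G) :
    LocallyIntegrable G := by
  induction k generalizing G with
  | zero => exact h.1 ▸ h.2.locallyIntegrable
  | succ k ih =>
    obtain ⟨ψ, c, h1, h2⟩ := h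
    have hψ := ih h1
    have : G = fun x => c + ∫ y in (0 : ℝ)..x, ψ y := funext h2
    rw [this]
    refine Continuous.locallyIntegrable (continuous_const.add ?_)
    exact intervalIntegral.continuous_primitive (intervalIntegrable_of_locallyIntegrable hψ) 0

/-- Jackson's inequality for functions with a `k`-th derivative `φ` in `Lᵖ`, by iteration of the
case `k = 1`. -/
theorem exists_polynomial_approx (k : ℕ) : ∃ C : ℝ, 0 ≤ C ∧ ∀ (p : ℝ≥0∞) (_ : 1 ≤ p) (φ G : ℝ → ℝ)
    (_ : IsIteratedIntegral k φ G) (n : ℕ) (_ : k ≤ n), ∃ P : Polynomial ℝ, P.degree < n ∧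
      eLpNorm (fun x => G x - P.eval x) p (volume.restrict (Icc 0 1))
        ≤ ENNReal.ofReal (C / n ^ k) * eLpNorm φ p (volume.restrict (Icc 0 1)) := by
  induction k with
  | zero =>
    refine ⟨1, zero_le_one, fun p _ φ G h n _ => ⟨0, by simp, ?_⟩⟩
    simp [h.1]
  | succ k ih =>
    obtain ⟨C, hC0, hC⟩ := ih
    refine ⟨1024 * (2 ^ k * C), by positivity, fun p hp φ G h n hn => ?_⟩
    obtain ⟨ψ, c, h1, h2⟩ := h
    have hψ := h1.locallyIntegrable
    obtain ⟨n, rfl⟩ : ∃ m, n = m + 1 := ⟨n - 1, by omega⟩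
    obtain ⟨Q, hQdeg, hQ⟩ := hC p hp φ ψ h1 n (by omega)
    obtain ⟨A, hA, hAdeg⟩ : ∃ A : Polynomial ℝ, A.derivative = Q ∧ A.degree < (n + 1 : ℕ) := by
      by_cases hQ0 : Q = 0
      · exact ⟨0, by simp [hQ0], by simp⟩
      · obtain ⟨A, hA, hdeg⟩ := exists_polynomial_antiderivative Q
        refine ⟨A, hA, (Polynomial.degree_le_of_natDegree_le hdeg).trans_lt ?_⟩
        have := (Polynomial.natDegree_lt_iff_degree_lt hQ0).2 hQdeg
        exact_mod_cast Nat.succ_lt_succ this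
    have hloc : LocallyIntegrable fun x => ψ x - Q.eval x :=
      hψ.sub Q.continuous.locallyIntegrable
    obtain ⟨P, hPdeg, hP⟩ := exists_polynomial_approx_primitive hp (n := n + 1) (by omega)
      (hloc.integrableOn_isCompact isCompact_Icc)
    refine ⟨Polynomial.C (c - A.eval 0) + A + P, ?_, ?_⟩
    · rw [← Polynomial.mem_degreeLT] at hAdeg hPdeg ⊢
      refine Submodule.add_mem _ (Submodule.add_mem _ ?_ hAdeg) hPdeg
      rw [Polynomial.mem_degreeLT]
      exact Polynomial.degree_C_le.trans_lt (by exact_mod_cast Nat.succ_pos n)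
    have e : (fun x => G x - (Polynomial.C (c - A.eval 0) + A + P).eval x)
        = fun x => (∫ u in (0 : ℝ)..x, ψ u - Q.eval u) - P.eval x := by
      funext x
      rw [intervalIntegral.integral_sub (intervalIntegrable_of_locallyIntegrable hψ _ _)
        (Q.continuous.intervalIntegrable _ _), ← hA, integral_eval_derivative, h2]
      simp only [Polynomial.eval_add, Polynomial.eval_C]
      ring
    rw [e]
    refine hP.trans ?_
    calc _ ≤ ENNReal.ofReal (1024 / (n + 1 : ℕ)) * (ENNReal.ofReal (C / n ^ k) *
          eLpNorm φ p (volume.restrict (Icc 0 1))) := by gcongr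
      _ = ENNReal.ofReal (1024 / (n + 1 : ℕ) * (C / n ^ k)) *
          eLpNorm φ p (volume.restrict (Icc 0 1)) := by
          rw [← mul_assoc, ENNReal.ofReal_mul (by positivity)]
      _ ≤ _ := by
          gcongr
          have hk : (n + 1 : ℝ) ^ k ≤ 2 ^ k * n ^ k := by
            rcases Nat.eq_zero_or_pos k with rfl | hk
            · simp
            · have : (1 : ℝ) ≤ n := by exact_mod_cast (by omega : 1 ≤ n)
              rw [← mul_pow]
              gcongr
              linarith
          have hn0 : (0 : ℝ) < n ^ k := by
            have : (0 : ℝ) < (n + 1 : ℝ) ^ k := by positivity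
            by_contra h
            nlinarith [pow_pos (two_pos : (0 : ℝ) < 2) k]
          rw [div_mul_div_comm, div_le_div_iff₀ (by positivity) (by positivity)]
          push_cast
          have : C * (n + 1 : ℝ) ^ k ≤ C * (2 ^ k * n ^ k) := by gcongr
          calc 1024 * C * (n + 1 : ℝ) ^ (k + 1) = 1024 * (n + 1) * (C * (n + 1 : ℝ) ^ k) := by ring
            _ ≤ 1024 * (n + 1) * (C * (2 ^ k * n ^ k)) := by gcongr
            _ = _ := by ring

end IsIteratedIntegral

namespace IsIteratedIntegral

theorem const_mul {k : ℕ} {φ G : ℝ → ℝ} (h : IsIteratedIntegral k φ G) (c : ℝ) :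
    IsIteratedIntegral k (fun x => c * φ x) (fun x => c * G x) := by
  induction k generalizing G with
  | zero => exact ⟨by rw [h.1], h.2.const_mul c⟩
  | succ k ih =>
    obtain ⟨ψ, d, h1, h2⟩ := h
    refine ⟨_, c * d, ih h1, fun x => ?_⟩
    beta_reduce
    rw [h2, intervalIntegral.integral_const_mul]
    ring

theorem sum {ι : Type*} (s : Finset ι) {k : ℕ} {φ G : ι → ℝ → ℝ}
    (h : ∀ i, IsIteratedIntegral k (φ i) (G i)) :
    IsIteratedIntegral k (fun x => ∑ i ∈ s, φ i x) (fun x => ∑ i ∈ s, G i x) := by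
  induction k generalizing G with
  | zero =>
    refine ⟨?_, integrable_finsetSum _ fun i _ => (h i).2⟩
    simp only [fun i => (h i).1]
  | succ k ih =>
    choose ψ d h1 h2 using h
    refine ⟨_, ∑ i ∈ s, d i, ih h1, fun x => ?_⟩
    rw [intervalIntegral.integral_finsetSum fun i _ =>
      intervalIntegrable_of_locallyIntegrable (h1 i).locallyIntegrable _ _,
      ← Finset.sum_add_distrib]
    exact Finset.sum_congr rfl fun i _ => h2 i x

theorem comp_add_right {k : ℕ} {φ G : ℝ → ℝ} (h : IsIteratedIntegral k φ G) (t : ℝ) :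
    IsIteratedIntegral k (fun x => φ (x + t)) (fun x => G (x + t)) := by
  induction k generalizing G with
  | zero => exact ⟨by rw [h.1], h.2.comp_add_right t⟩
  | succ k ih =>
    obtain ⟨ψ, d, h1, h2⟩ := h
    refine ⟨_, d + ∫ y in (0 : ℝ)..t, ψ y, ih h1, fun x => ?_⟩
    have hi := intervalIntegrable_of_locallyIntegrable h1.locallyIntegrable
    beta_reduce
    rw [h2, intervalIntegral.integral_comp_add_right, zero_add, add_assoc,
      intervalIntegral.integral_add_adjacent_intervals (hi _ _) (hi _ _)]

theorem comp_mul_left {k : ℕ} {φ G : ℝ → ℝ} (h : IsIteratedIntegral k φ G) {a : ℝ} (ha : a ≠ 0) :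
    IsIteratedIntegral k (fun x => a ^ k * φ (a * x)) (fun x => G (a * x)) := by
  induction k generalizing G with
  | zero => exact ⟨by simp [h.1], by simpa using h.2.comp_mul_left' ha⟩
  | succ k ih =>
    obtain ⟨ψ, d, h1, h2⟩ := h
    refine ⟨fun x => a * ψ (a * x), d, ?_, fun x => ?_⟩
    · convert! (ih h1).const_mul a using 2 with x
      ring
    · beta_reduce
      rw [h2, intervalIntegral.integral_const_mul, intervalIntegral.integral_comp_mul_left _ ha,
        smul_eq_mul, mul_inv_cancel_left₀ ha, mul_zero]

/-- Averaging over a window of length `h` is one more integration of the difference quotient. -/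
theorem average {k : ℕ} {φ G : ℝ → ℝ} (hG : IsIteratedIntegral k φ G) {h : ℝ} (hh : h ≠ 0) :
    IsIteratedIntegral (k + 1) (fun x => h⁻¹ * (φ (x + h) - φ x))
      (fun x => ∫ u in (0 : ℝ)..1, G (x + h * u)) := by
  refine ⟨fun x => h⁻¹ * (G (x + h) - G x), h⁻¹ * ∫ y in (0 : ℝ)..h, G y, ?_, fun x => ?_⟩
  · have h1 := sum (Finset.univ : Finset Bool)
      (φ := fun b x => if b then h⁻¹ * φ (x + h) else -h⁻¹ * φ x)
      (G := fun b x => if b then h⁻¹ * G (x + h) else -h⁻¹ * G x) (k := k) (fun b => by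
        cases b
        · simpa using hG.const_mul (-h⁻¹)
        · simpa using (hG.comp_add_right h).const_mul h⁻¹)
    convert! h1 using 2 with x x
    · simp; ring
    · simp; ring
  · have hi := intervalIntegrable_of_locallyIntegrable hG.locallyIntegrable
    have hi' := intervalIntegrable_of_locallyIntegrable (hG.comp_add_right h).locallyIntegrable
    beta_reduce
    rw [intervalIntegral.integral_comp_add_mul _ hh, intervalIntegral.integral_const_mul,
      intervalIntegral.integral_sub (hi' _ _) (hi _ _), intervalIntegral.integral_comp_add_right,
      ← mul_add, smul_eq_mul, mul_zero, mul_one, add_zero, zero_add,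
      ← intervalIntegral.integral_interval_sub_left (hi 0 (x + h)) (hi 0 x),
      ← intervalIntegral.integral_interval_sub_left (hi 0 (x + h)) (hi 0 h)]
    ring

end IsIteratedIntegral

/-! ### Sums of uniform variables and Steklov averages -/

/-- The distribution of a sum of `k` independent uniform random variables on `[0, 1]`; for `k ≥ 1`
its density is the cardinal B-spline. -/
noncomputable def uniformSum : ℕ → Measure ℝ
  | 0 => Measure.dirac 0
  | k + 1 => (volume.restrict (Ioc 0 1)) ∗ (uniformSum k)

instance isProbabilityMeasure_uniformSum (k : ℕ) : IsProbabilityMeasure (uniformSum k) := by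
  induction k with
  | zero => exact Measure.dirac.isProbabilityMeasure
  | succ k ih =>
    have : IsProbabilityMeasure (volume.restrict (Ioc (0 : ℝ) 1)) := ⟨by simp⟩
    rw [uniformSum]
    infer_instance

theorem ae_uniformSum_mem_Icc (k : ℕ) : ∀ᵐ s ∂uniformSum k, s ∈ Icc (0 : ℝ) k := by
  induction k with
  | zero =>
    rw [uniformSum, ae_dirac_iff (by measurability)]
    simp
  | succ k ih =>
    have hm : MeasurableSet (Icc (0 : ℝ) (k + 1 : ℕ))ᶜ := measurableSet_Icc.compl
    rw [ae_iff]
    change uniformSum (k + 1) (Icc (0 : ℝ) (k + 1 : ℕ))ᶜ = 0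
    rw [uniformSum, ← lintegral_indicator_one hm,
      Measure.lintegral_conv (measurable_one.indicator hm),
      ← lintegral_zero (μ := volume.restrict (Ioc (0 : ℝ) 1))]
    refine setLIntegral_congr_fun measurableSet_Ioc fun x hx => ?_
    rw [← lintegral_zero (μ := uniformSum k)]
    refine lintegral_congr_ae ?_
    filter_upwards [ih] with y hy
    refine indicator_of_notMem ?_ _
    rw [notMem_compl_iff]
    push_cast
    exact ⟨add_nonneg hx.1.le hy.1, by linarith [hx.2, hy.2]⟩

theorem uniformSum_le_volume (k : ℕ) : uniformSum (k + 1) ≤ volume := by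
  refine Measure.le_iff.2 fun s hs => ?_
  rw [uniformSum, Measure.conv_comm, ← lintegral_indicator_one hs,
    Measure.lintegral_conv (measurable_one.indicator hs)]
  calc ∫⁻ x, ∫⁻ y in Ioc 0 1, s.indicator 1 (x + y) ∂volume ∂uniformSum k
      ≤ ∫⁻ x, ∫⁻ y, s.indicator 1 (x + y) ∂volume ∂uniformSum k :=
        lintegral_mono fun x => lintegral_mono' Measure.restrict_le_self le_rfl
    _ = ∫⁻ _, volume s ∂uniformSum k := by
        refine lintegral_congr fun x => ?_
        rw [lintegral_add_left_eq_self (fun y => s.indicator 1 y) x, lintegral_indicator_one hs]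
    _ = volume s := by simp

theorem integrable_comp_affine_uniformSum {F : ℝ → ℝ} (hF : Integrable F) (k : ℕ) (y : ℝ) {h : ℝ}
    (hh : h ≠ 0) : Integrable (fun s => F (y + h * s)) (uniformSum (k + 1)) := by
  refine Integrable.mono_measure ?_ (uniformSum_le_volume k)
  exact (hF.comp_add_left y).comp_mul_left' hh

/-- The Steklov average of order `k` of `F` is a `k`-fold integral of its `k`-th difference
quotient. -/
theorem isIteratedIntegral_steklov {F : ℝ → ℝ} (hF : Integrable F) {h : ℝ} (hh : h ≠ 0) (k : ℕ) :
    IsIteratedIntegral k (fun x => h⁻¹ ^ k * (fwdDiff h)^[k] F x)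
      (fun y => ∫ s, F (y + h * s) ∂uniformSum k) := by
  induction k with
  | zero => exact ⟨by simp [uniformSum], by simpa using hF⟩
  | succ k ih =>
    convert! ih.average hh using 2 with x y
    · rw [Function.iterate_succ_apply', fwdDiff]
      ring
    · have hi := integrable_comp_affine_uniformSum hF k y hh
      rw [uniformSum] at hi ⊢
      rw [integral_conv hi, intervalIntegral.integral_of_le zero_le_one]
      refine integral_congr_ae (ae_of_all _ fun u => ?_)
      refine integral_congr_ae (ae_of_all _ fun s => ?_)
      simp only
      congr 1
      ring

/-! ### Differences with variable step -/

theorem fwdDiff_neg_iterate (F : ℝ → ℝ) (h : ℝ) (k : ℕ) (x : ℝ) :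
    (fwdDiff (-h))^[k] F x = (-1) ^ k * (fwdDiff h)^[k] F (x - k * h) := by
  induction k generalizing x with
  | zero => simp
  | succ k ih =>
    rw [Function.iterate_succ_apply', Function.iterate_succ_apply', fwdDiff, fwdDiff, ih, ih]
    have e1 : x + -h - k * h = x - (k + 1 : ℕ) * h := by push_cast; ring
    have e2 : x - k * h = x - (k + 1 : ℕ) * h + h := by push_cast; ring
    rw [e1, e2]
    ring

theorem fwdDiff_iterate_eq_sum (F : ℝ → ℝ) (h : ℝ) (r : ℕ) (x : ℝ) :
    (fwdDiff h)^[r] F x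
      = ∑ j ∈ Finset.range (r + 1), ((-1 : ℝ) ^ (r - j) * r.choose j) * F (x + j * h) := by
  rw [fwdDiff_iter_eq_sum_shift]
  refine Finset.sum_congr rfl fun j _ => ?_
  simp

theorem fwdDiff_zero_iterate (F : ℝ → ℝ) {r : ℕ} (hr : 1 ≤ r) (x : ℝ) :
    (fwdDiff (0 : ℝ))^[r] F x = 0 := by
  obtain ⟨k, rfl⟩ : ∃ k, r = k + 1 := ⟨r - 1, by omega⟩
  rw [Function.iterate_succ_apply', fwdDiff, add_zero, sub_self]

theorem measurable_fwdDiff_iterate {X : Type*} [MeasurableSpace X] {F : ℝ → ℝ} (hF : Measurable F)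
    (r : ℕ) {h x : X → ℝ} (hh : Measurable h) (hx : Measurable x) :
    Measurable fun z => (fwdDiff (h z))^[r] F (x z) := by
  simp only [fwdDiff_iterate_eq_sum]
  refine Finset.measurable_sum _ fun j _ => ?_
  exact (hF.comp (hx.add (hh.const_mul _))).const_mul _

theorem lintegral_comp_const_mul {τ : ℝ} (hτ : 0 < τ) {Θ : ℝ → ℝ≥0∞} (hΘ : Measurable Θ) :
    ∫⁻ s, Θ (τ * s) = ENNReal.ofReal τ⁻¹ * ∫⁻ h, Θ h := by
  rw [← lintegral_map hΘ (measurable_const_mul τ), Real.map_volume_mul_left hτ.ne',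
    lintegral_smul_measure, abs_of_pos (inv_pos.2 hτ), smul_eq_mul]

/-- The step `τ (s - r x)` with `s ∈ [0, r]` is such that `x` and `x + r τ (s - r x)` both lie in
`[0, 1]`. Averages over `s` of functions of the differences with this variable step are controlled
by the same quantities for the constant steps `0 < h ≤ r τ`: substitute the step for `s` and
exchange the integrals. -/
theorem lintegral_variable_step_le {r : ℕ} (hr : 1 ≤ r) {τ : ℝ} (hτ0 : 0 < τ)
    (hτ : r * (r * τ) ≤ 1) {F : ℝ → ℝ} (hF : Measurable F) {N : ℝ≥0∞ → ℝ≥0∞} (hN : Measurable N)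
    (hN0 : N 0 = 0) {B : ℝ≥0∞}
    (hB : ∀ h ∈ Ioc 0 (r * τ), ∫⁻ x in Icc 0 (1 - r * h), N ‖(fwdDiff h)^[r] F x‖ₑ ≤ B) :
    ∫⁻ x in Icc (0 : ℝ) 1, ∫⁻ s, N ‖(fwdDiff (τ * (s - r * x)))^[r] F x‖ₑ ∂uniformSum r
      ≤ 2 * r * B := by
  set Θ : ℝ → ℝ → ℝ≥0∞ := fun h x => N ‖(fwdDiff h)^[r] F x‖ₑ with hΘ
  have hΘm : Measurable (Function.uncurry Θ) :=
    hN.comp (measurable_fwdDiff_iterate hF r measurable_fst measurable_snd).enorm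
  set Ω : Set (ℝ × ℝ) := {z | z.1 ∈ Icc (-(r * τ)) (r * τ) ∧ z.2 + r * z.1 ∈ Icc (0 : ℝ) 1} with hΩ
  have hΩm : MeasurableSet Ω :=
    (measurableSet_Icc.preimage measurable_fst).inter
      (measurableSet_Icc.preimage (measurable_snd.add (measurable_fst.const_mul _)))
  set g : ℝ × ℝ → ℝ≥0∞ := Ω.indicator (Function.uncurry Θ) with hg
  have hgm : Measurable g := hΘm.indicator hΩm
  have hr1 : (1 : ℝ) ≤ r := by exact_mod_cast hr
  have hle : uniformSum r ≤ volume := by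
    obtain ⟨k, rfl⟩ : ∃ k, r = k + 1 := ⟨r - 1, by omega⟩
    exact uniformSum_le_volume k
  have step1 : ∀ x ∈ Icc (0 : ℝ) 1, ∫⁻ s, Θ (τ * (s - r * x)) x ∂uniformSum r
      ≤ ENNReal.ofReal τ⁻¹ * ∫⁻ h, g (h, x) := by
    intro x hx
    have hm : Measurable fun h => g (h, x) := hgm.comp measurable_prodMk_right
    calc ∫⁻ s, Θ (τ * (s - r * x)) x ∂uniformSum r
        ≤ ∫⁻ s, g (τ * (s - r * x), x) ∂uniformSum r := by
          refine lintegral_mono_ae ?_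
          filter_upwards [ae_uniformSum_mem_Icc r] with s hs
          rw [hg, indicator_of_mem]
          · rfl
          · have h1 : 0 ≤ r * (1 - x) := mul_nonneg (by linarith) (by linarith [hx.2])
            have h2 : 0 ≤ r * x := mul_nonneg (by linarith) hx.1
            refine ⟨⟨?_, ?_⟩, ?_, ?_⟩
            · nlinarith [hs.1]
            · nlinarith [hs.2]
            · have : x + r * (τ * (s - r * x)) = x * (1 - r * (r * τ)) + r * τ * s := by ring
              rw [this]
              have := hx.1
              have := hs.1
              have : 0 ≤ 1 - r * (r * τ) := by linarith
              positivity
            · have : x + r * (τ * (s - r * x))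
                  = 1 - ((1 - x) * (1 - r * (r * τ)) + r * τ * (r - s)) := by ring
              rw [this]
              have h3 : 0 ≤ 1 - x := by linarith [hx.2]
              have h4 : 0 ≤ r - s := by linarith [hs.2]
              have h5 : 0 ≤ 1 - r * (r * τ) := by linarith
              have : 0 ≤ (1 - x) * (1 - r * (r * τ)) + r * τ * (r - s) := by positivity
              linarith
      _ ≤ ∫⁻ s, g (τ * (s - r * x), x) := lintegral_mono' hle le_rfl
      _ = ∫⁻ s, g (τ * s, x) :=
          lintegral_sub_right_eq_self (fun s => g (τ * s, x)) (r * x)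
      _ = _ := lintegral_comp_const_mul hτ0 hm
  have step2 : ∀ h : ℝ, ∫⁻ x in Icc (0 : ℝ) 1, g (h, x)
      ≤ (Icc (-(r * τ)) (r * τ)).indicator (fun _ => B) h := by
    intro h
    by_cases hh : h ∈ Icc (-(r * τ)) (r * τ)
    swap
    · have : ∀ x, g (h, x) = 0 := fun x => indicator_of_notMem (fun hz => hh hz.1) _
      simp [this]
    rw [indicator_of_mem hh, ← lintegral_indicator measurableSet_Icc]
    rcases lt_trichotomy h 0 with hneg | rfl | hpos
    · obtain ⟨η, rfl⟩ : ∃ η, h = -η := ⟨-h, by ring⟩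
      refine le_trans ?_ (hB η ⟨by linarith, by linarith [hh.1]⟩)
      rw [← lintegral_indicator measurableSet_Icc, ← lintegral_sub_right_eq_self
        ((Icc (0 : ℝ) (1 - r * η)).indicator fun x => N ‖(fwdDiff η)^[r] F x‖ₑ) (r * η)]
      refine lintegral_mono fun x => ?_
      by_cases hx : x ∈ Icc (0 : ℝ) 1
      swap
      · rw [indicator_of_notMem hx]; exact zero_le
      rw [indicator_of_mem hx]
      by_cases hz : (-η, x) ∈ Ω
      swap
      · rw [hg, indicator_of_notMem hz]; exact zero_le
      rw [hg, indicator_of_mem hz, indicator_of_mem]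
      · simp [hΘ, Function.uncurry, fwdDiff_neg_iterate, enorm_mul]
      · have := hz.2.1
        simp only at this
        exact ⟨by linarith, by linarith [hx.2]⟩
    · have : ∀ x, g (0, x) = 0 := fun x => by
        by_cases hz : ((0 : ℝ), x) ∈ Ω
        · rw [hg, indicator_of_mem hz]
          simp [hΘ, Function.uncurry, fwdDiff_zero_iterate F hr, hN0]
        · exact indicator_of_notMem hz _
      simp [this]
    · refine le_trans ?_ (hB h ⟨hpos, hh.2⟩)
      rw [← lintegral_indicator measurableSet_Icc]
      refine lintegral_mono fun x => ?_
      by_cases hx : x ∈ Icc (0 : ℝ) 1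
      swap
      · rw [indicator_of_notMem hx]; exact zero_le
      rw [indicator_of_mem hx]
      by_cases hz : (h, x) ∈ Ω
      swap
      · rw [hg, indicator_of_notMem hz]; exact zero_le
      rw [hg, indicator_of_mem hz, indicator_of_mem]
      · rfl
      · have := hz.2.2
        simp only at this
        exact ⟨hx.1, by linarith⟩
  calc ∫⁻ x in Icc (0 : ℝ) 1, ∫⁻ s, Θ (τ * (s - r * x)) x ∂uniformSum r
      ≤ ∫⁻ x in Icc (0 : ℝ) 1, ENNReal.ofReal τ⁻¹ * ∫⁻ h, g (h, x) :=
        setLIntegral_mono' measurableSet_Icc step1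
    _ = ENNReal.ofReal τ⁻¹ * ∫⁻ h, ∫⁻ x in Icc (0 : ℝ) 1, g (h, x) := by
        rw [lintegral_const_mul' _ _ ENNReal.ofReal_ne_top, lintegral_lintegral_swap]
        exact (hgm.comp measurable_swap).aemeasurable
    _ ≤ ENNReal.ofReal τ⁻¹ * ∫⁻ h, (Icc (-(r * τ)) (r * τ)).indicator (fun _ => B) h := by
        gcongr with h
        exact step2 h
    _ = 2 * r * B := by
        rw [lintegral_indicator measurableSet_Icc, setLIntegral_const, Real.volume_Icc, mul_comm B,
          ← mul_assoc, ← ENNReal.ofReal_mul (by positivity)]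
        have : τ⁻¹ * (r * τ - -(r * τ)) = 2 * r := by field_simp; ring
        rw [this, ENNReal.ofReal_mul (by norm_num), ENNReal.ofReal_natCast]
        norm_num

/-- The mean over `s` of the `r`-th differences of `F` with step `τ (s - r x)` is bounded in `Lᵖ` by
the differences with constant steps. -/
theorem eLpNorm_variable_step_le {r : ℕ} (hr : 1 ≤ r) {τ : ℝ} (hτ0 : 0 < τ)
    (hτ : r * (r * τ) ≤ 1) {F : ℝ → ℝ} (hF : Measurable F) {p : ℝ≥0∞} (hp : 1 ≤ p) {W : ℝ≥0∞}
    (hW : ∀ h ∈ Ioc 0 (r * τ),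
      eLpNorm ((fwdDiff h)^[r] F) p (volume.restrict (Icc 0 (1 - r * h))) ≤ W) :
    eLpNorm (fun x => ∫⁻ s, ‖(fwdDiff (τ * (s - r * x)))^[r] F x‖ₑ ∂uniformSum r) p
      (volume.restrict (Icc 0 1)) ≤ 2 * r * W := by
  have hAm : Measurable (Function.uncurry
      fun x s : ℝ => ‖(fwdDiff (τ * (s - r * x)))^[r] F x‖ₑ) :=
    (measurable_fwdDiff_iterate hF r (by fun_prop) measurable_fst).enorm
  have h := eLpNorm_lintegral_le (volume.restrict (Icc (0 : ℝ) 1)) (uniformSum r) hp hAm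
    (2 * r * W) ?_ ?_
  · rwa [measure_univ, one_mul] at h
  · intro hpt
    have hp0 : p ≠ 0 := (zero_lt_one.trans_le hp).ne'
    have hq0 : 0 < p.toReal := ENNReal.toReal_pos hp0 hpt
    have hq1 : 1 ≤ p.toReal := by
      rw [← ENNReal.toReal_one]
      exact ENNReal.toReal_mono hpt hp
    refine (lintegral_variable_step_le hr hτ0 hτ hF (N := fun y => y ^ p.toReal)
      (B := W ^ p.toReal) (measurable_id.pow_const _) (ENNReal.zero_rpow_of_pos hq0)
      fun h hh => ?_).trans ?_
    · have := hW h hh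
      rwa [eLpNorm_eq_lintegral_rpow_enorm_toReal hp0 hpt, one_div,
        ENNReal.rpow_inv_le_iff hq0] at this
    · rw [measure_univ, one_mul, ENNReal.mul_rpow_of_nonneg _ _ hq0.le]
      gcongr
      have h1 : (1 : ℝ≥0∞) ≤ 2 * r := by
        exact_mod_cast (by omega : 1 ≤ 2 * r)
      calc (2 * r : ℝ≥0∞) = (2 * r) ^ (1 : ℝ) := (ENNReal.rpow_one _).symm
        _ ≤ _ := ENNReal.rpow_le_rpow_of_exponent_le h1 hq1
  · rintro rfl
    have hr1 : (1 : ℝ≥0∞) ≤ 2 * r := by exact_mod_cast (by omega : 1 ≤ 2 * r)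
    -- with `N` the indicator of `(W, ∞]`, the hypothesis says that `N` vanishes almost everywhere
    have h0 := lintegral_variable_step_le hr hτ0 hτ hF (N := (Ioi W).indicator 1) (B := 0)
      (measurable_one.indicator measurableSet_Ioi) (by simp) fun h hh => by
        rw [nonpos_iff_eq_zero, ← lintegral_zero
          (μ := volume.restrict (Icc (0 : ℝ) (1 - r * h)))]
        refine lintegral_congr_ae ?_
        have hb := ae_le_eLpNormEssSup (μ := volume.restrict (Icc (0 : ℝ) (1 - r * h)))
          (f := (fwdDiff h)^[r] F)
        filter_upwards [hb] with x hx
        refine indicator_of_notMem ?_ _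
        exact not_lt.2 (hx.trans (by simpa [eLpNorm_exponent_top] using hW h hh))
    have hNm : Measurable ((Ioi W).indicator (1 : ℝ≥0∞ → ℝ≥0∞)) :=
      measurable_one.indicator measurableSet_Ioi
    rw [mul_zero, nonpos_iff_eq_zero, lintegral_eq_zero_iff (Measurable.lintegral_prod_right'
      (f := fun z : ℝ × ℝ => (Ioi W).indicator (1 : ℝ≥0∞ → ℝ≥0∞)
        ‖(fwdDiff (τ * (z.2 - r * z.1)))^[r] F z.1‖ₑ) (hNm.comp hAm))] at h0
    filter_upwards [h0] with x hx
    have hx' := (lintegral_eq_zero_iff (μ := uniformSum r)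
      (hNm.comp (hAm.comp (measurable_prodMk_left (x := x))))).1 hx
    filter_upwards [hx'] with s hs
    by_contra hlt
    have hmem : ‖(fwdDiff (τ * (s - r * x)))^[r] F x‖ₑ ∈ Ioi W :=
      lt_of_le_of_lt (le_mul_of_one_le_left zero_le hr1) (not_le.1 hlt)
    change (Ioi W).indicator (1 : ℝ≥0∞ → ℝ≥0∞) ‖(fwdDiff (τ * (s - r * x)))^[r] F x‖ₑ = 0 at hs
    rw [indicator_of_mem hmem] at hs
    simp at hs

theorem eLpNorm_comp_mul_left_le {p : ℝ≥0∞} (hp : 1 ≤ p) {u : ℝ → ℝ} (hu : Measurable u) {a : ℝ}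
    (ha : 1 / 2 ≤ a) (ha1 : a ≤ 1) :
    eLpNorm (fun x => u (a * x)) p (volume.restrict (Icc 0 1))
      ≤ 2 * eLpNorm u p (volume.restrict (Icc 0 a)) := by
  have ha0 : 0 < a := by linarith
  have hmap : Measure.map (fun x => a * x) (volume.restrict (Icc (0 : ℝ) 1))
      = ENNReal.ofReal a⁻¹ • volume.restrict (Icc 0 a) := by
    have : Icc (0 : ℝ) 1 = (fun x => a * x) ⁻¹' Icc 0 a := by
      ext x
      simp only [mem_Icc, mem_preimage]
      constructor
      · rintro ⟨h1, h2⟩; exact ⟨by positivity, by nlinarith⟩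
      · rintro ⟨h1, h2⟩
        exact ⟨nonneg_of_mul_nonneg_right h1 ha0, by
          by_contra h; nlinarith [mul_lt_mul_of_pos_left (not_le.1 h) ha0]⟩
    rw [this, ← Measure.restrict_map (measurable_const_mul a) measurableSet_Icc,
      Real.map_volume_mul_left ha0.ne', Measure.restrict_smul, abs_of_pos (inv_pos.2 ha0)]
  have h := eLpNorm_map_measure (p := p) (μ := volume.restrict (Icc (0 : ℝ) 1))
    (f := fun x => a * x) (g := u) hu.aestronglyMeasurable (measurable_const_mul a).aemeasurable
  change eLpNorm (u ∘ fun x => a * x) p _ ≤ _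
  rw [← h, hmap]
  refine (eLpNorm_smul_measure_le _ _ _ _).trans ?_
  rw [smul_eq_mul]
  gcongr
  have h1 : 1 ≤ ENNReal.ofReal a⁻¹ := by
    rw [ENNReal.one_le_ofReal]; exact (one_le_inv₀ ha0).2 ha1
  have h2 : ENNReal.ofReal a⁻¹ ≤ 2 := by
    rw [← ENNReal.ofReal_ofNat 2]
    refine ENNReal.ofReal_le_ofReal ?_
    rw [inv_le_comm₀ ha0 two_pos]; linarith
  calc ENNReal.ofReal a⁻¹ ^ (1 / p).toReal ≤ ENNReal.ofReal a⁻¹ ^ (1 : ℝ) := by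
        refine ENNReal.rpow_le_rpow_of_exponent_le h1 ?_
        rw [← ENNReal.toReal_one]
        refine ENNReal.toReal_mono ENNReal.one_ne_top ?_
        rw [one_div]
        exact ENNReal.inv_le_one.2 hp
    _ ≤ 2 := by rwa [ENNReal.rpow_one]

/-! ### The Jackson–Stechkin inequality -/

/-- A function on `[0, 1]` is approximated to within its modulus of smoothness by an `r`-fold
integral. The approximant averages `F(x + j τ (s - r x))` over `s`, i.e. it contracts the argument
towards a variable point of `[0, 1]`, so that no extension of `F` beyond `[0, 1]` is needed. -/
theorem exists_iteratedIntegral_approx {r : ℕ} (hr : 1 ≤ r) : ∃ C : ℝ, 0 ≤ C ∧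
    ∀ (p : ℝ≥0∞) (_ : 1 ≤ p) (F : ℝ → ℝ) (_ : Measurable F) (_ : Integrable F) (n : ℕ) (_ : r ≤ n)
      (W : ℝ≥0∞) (_ : ∀ h ∈ Ioc 0 (1 / (n : ℝ)),
        eLpNorm ((fwdDiff h)^[r] F) p (volume.restrict (Icc 0 (1 - r * h))) ≤ W),
      ∃ φ g, IsIteratedIntegral r φ g ∧
        eLpNorm (fun x => F x - g x) p (volume.restrict (Icc 0 1)) ≤ 2 * r * W ∧
        eLpNorm φ p (volume.restrict (Icc 0 1)) ≤ ENNReal.ofReal (C * n ^ r) * W := by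
  refine ⟨r * (2 ^ r * (2 * r) ^ r * 2), by positivity, fun p hp F hF hFi n hn W hW => ?_⟩
  have hr1 : (1 : ℝ) ≤ r := by exact_mod_cast hr
  have hn1 : (1 : ℝ) ≤ n := by exact_mod_cast hr.trans hn
  have hrn : (r : ℝ) ≤ n := by exact_mod_cast hn
  -- with this step, `a j = 1 - r * H j ≥ 1/2` below, so rescaling by `a j` costs at most a factor 2
  set τ : ℝ := 1 / (2 * r * n) with hτdef
  have hτ0 : 0 < τ := by positivity
  have hrτ : r * τ = 1 / (2 * n) := by rw [hτdef]; field_simp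
  have hrrτ : r * (r * τ) ≤ 1 / 2 := by
    rw [hrτ, mul_one_div, div_le_div_iff₀ (by positivity) two_pos]; linarith
  have hrτn : r * τ ≤ 1 / n := by
    rw [hrτ]; exact one_div_le_one_div_of_le (by linarith) (by linarith)
  set c : ℕ → ℝ := fun j => (-1 : ℝ) ^ (r - j) * r.choose j with hc
  set H : Fin r → ℝ := fun j => (j + 1 : ℕ) * τ with hH
  set a : Fin r → ℝ := fun j => 1 - r * H j with ha
  set e : Fin r → ℝ := fun j => (-1) ^ (r + 1) * c (j + 1) with he
  have hH0 : ∀ j, 0 < H j := fun j => by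
    have : (0 : ℝ) < (j + 1 : ℕ) := by positivity
    exact mul_pos this hτ0
  have hHr : ∀ j, H j ≤ r * τ := fun j => by
    have : ((j + 1 : ℕ) : ℝ) ≤ r := by exact_mod_cast j.2
    exact mul_le_mul_of_nonneg_right this hτ0.le
  have ha2 : ∀ j, 1 / 2 ≤ a j := fun j => by
    have : r * H j ≤ r * (r * τ) := mul_le_mul_of_nonneg_left (hHr j) (by linarith)
    simp only [ha]; linarith
  have ha1 : ∀ j, a j ≤ 1 := fun j => by
    have := mul_pos (by linarith : (0 : ℝ) < r) (hH0 j)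
    simp only [ha]; linarith
  have ha0 : ∀ j, a j ≠ 0 := fun j => by linarith [ha2 j]
  set g : ℝ → ℝ := fun x => ∑ j : Fin r, e j * ∫ s, F (a j * x + H j * s) ∂uniformSum r with hg
  set φ : ℝ → ℝ := fun x => ∑ j : Fin r,
    e j * (a j ^ r * ((H j)⁻¹ ^ r * (fwdDiff (H j))^[r] F (a j * x))) with hφ
  refine ⟨φ, g, ?_, ?_, ?_⟩
  · exact IsIteratedIntegral.sum Finset.univ fun j =>
      ((isIteratedIntegral_steklov hFi (hH0 j).ne' r).comp_mul_left (ha0 j)).const_mul (e j)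
  · have hpt : ∀ x, F x - g x
        = (-1) ^ r * ∫ s, (fwdDiff (τ * (s - r * x)))^[r] F x ∂uniformSum r := by
      intro x
      have hterm : ∀ (j : Fin r) (s : ℝ), F (x + (j + 1 : ℕ) * (τ * (s - r * x)))
          = F (a j * x + H j * s) := fun j s => by
        congr 1; simp only [ha, hH]; ring
      have hint : ∀ j : Fin r,
          Integrable (fun s => F (x + (j + 1 : ℕ) * (τ * (s - r * x)))) (uniformSum r) := by
        intro j
        simp only [hterm]
        obtain ⟨k, rfl⟩ : ∃ k, r = k + 1 := ⟨r - 1, by omega⟩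
        exact integrable_comp_affine_uniformSum hFi k _ (hH0 j).ne'
      have hexp : ∀ s, (fwdDiff (τ * (s - r * x)))^[r] F x
          = (-1) ^ r * F x
            + ∑ j : Fin r, c (j + 1) * F (x + (j + 1 : ℕ) * (τ * (s - r * x))) := by
        intro s
        rw [fwdDiff_iterate_eq_sum, Finset.sum_range_succ', add_comm, Finset.sum_range]
        simp [hc]
      simp only [hexp]
      rw [integral_add (integrable_const _)
        (integrable_finsetSum _ fun j _ => (hint j).const_mul _), integral_const,
        integral_finsetSum _ fun j _ => (hint j).const_mul _]
      simp only [integral_const_mul, hterm, probReal_univ, one_smul]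
      rw [mul_add, ← mul_assoc, ← mul_pow, neg_one_mul, neg_neg, one_pow, one_mul,
        sub_eq_add_neg, Finset.mul_sum, hg, ← Finset.sum_neg_distrib]
      congr 1
      refine Finset.sum_congr rfl fun j _ => ?_
      simp only [he]
      ring
    refine le_trans (eLpNorm_mono_enorm_ae (ae_of_all _ fun x => ?_))
      (eLpNorm_variable_step_le hr hτ0 (by linarith) hF hp fun h hh =>
        hW h ⟨hh.1, hh.2.trans hrτn⟩)
    rw [hpt, enorm_mul, enorm_pow, enorm_neg, enorm_one, one_pow, one_mul, enorm_eq_self]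
    exact enorm_integral_le_lintegral_enorm _
  · have hdm : ∀ j, Measurable fun x => (fwdDiff (H j))^[r] F x := fun j =>
      measurable_fwdDiff_iterate hF r measurable_const measurable_id
    have hterm : ∀ j : Fin r, eLpNorm (fun x =>
        e j * (a j ^ r * ((H j)⁻¹ ^ r * (fwdDiff (H j))^[r] F (a j * x)))) p
          (volume.restrict (Icc 0 1)) ≤ ENNReal.ofReal (2 ^ r * (2 * r) ^ r * 2 * n ^ r) * W := by
      intro j
      have hfun : (fun x => e j * (a j ^ r * ((H j)⁻¹ ^ r * (fwdDiff (H j))^[r] F (a j * x))))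
          = (e j * a j ^ r * (H j)⁻¹ ^ r) • fun x => (fwdDiff (H j))^[r] F (a j * x) := by
        funext x
        simp only [Pi.smul_apply, smul_eq_mul]
        ring
      have hcoef : |e j * a j ^ r * (H j)⁻¹ ^ r| ≤ 2 ^ r * (2 * r) ^ r * n ^ r := by
        have h1 : |e j| ≤ 2 ^ r := by
          simp only [he, hc, abs_mul, abs_pow, abs_neg, abs_one, one_pow, one_mul, Nat.abs_cast]
          exact_mod_cast Nat.choose_le_two_pow r (j + 1)
        have h2 : |a j ^ r| ≤ 1 := by
          rw [abs_pow, abs_of_nonneg (by linarith [ha2 j])]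
          exact pow_le_one₀ (by linarith [ha2 j]) (ha1 j)
        have h3 : |(H j)⁻¹ ^ r| ≤ (2 * r * n) ^ r := by
          rw [abs_pow, abs_of_pos (inv_pos.2 (hH0 j))]
          gcongr
          rw [inv_le_comm₀ (hH0 j) (by positivity), ← one_div, ← hτdef]
          refine le_mul_of_one_le_left hτ0.le ?_
          exact_mod_cast Nat.succ_le_succ (Nat.zero_le _)
        calc |e j * a j ^ r * (H j)⁻¹ ^ r| = |e j| * |a j ^ r| * |(H j)⁻¹ ^ r| := by
              rw [abs_mul, abs_mul]
          _ ≤ 2 ^ r * 1 * (2 * r * n) ^ r := by gcongr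
          _ = _ := by rw [mul_pow]; ring
      rw [hfun, eLpNorm_const_smul, Real.enorm_eq_ofReal_abs]
      calc _ ≤ ENNReal.ofReal (2 ^ r * (2 * r) ^ r * n ^ r) * (2 * W) := by
            gcongr
            refine (eLpNorm_comp_mul_left_le hp (hdm j) (ha2 j) (ha1 j)).trans ?_
            gcongr
            exact hW (H j) ⟨hH0 j, (hHr j).trans hrτn⟩
        _ = _ := by
            rw [← mul_assoc, ← ENNReal.ofReal_ofNat 2, ← ENNReal.ofReal_mul (by positivity)]
            congr 2
            ring
    have hsum : φ = ∑ j : Fin r,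
        fun x => e j * (a j ^ r * ((H j)⁻¹ ^ r * (fwdDiff (H j))^[r] F (a j * x))) := by
      funext x
      simp [hφ]
    rw [hsum]
    refine (eLpNorm_sum_le (fun j _ => ?_) hp).trans ?_
    · exact (((((hdm j).comp (measurable_const_mul (a j))).const_mul _).const_mul _).const_mul
        _).aestronglyMeasurable
    · refine (Finset.sum_le_sum fun j _ => hterm j).trans ?_
      rw [Finset.sum_const, Finset.card_univ, Fintype.card_fin, nsmul_eq_mul, ← mul_assoc,
        ← ENNReal.ofReal_natCast r, ← ENNReal.ofReal_mul (by positivity)]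
      refine le_of_eq ?_
      congr 2
      ring

/-- The Jackson–Stechkin inequality for algebraic polynomials in `Lᵖ[0, 1]`, with a constant that
depends only on the order `r` of the modulus of smoothness. -/
theorem exists_polynomial_jackson {r : ℕ} (hr : 1 ≤ r) : ∃ C : ℝ≥0,
    ∀ (p : ℝ≥0∞) (_ : 1 ≤ p) (F : ℝ → ℝ) (_ : Measurable F) (_ : Integrable F) (n : ℕ) (_ : r ≤ n)
      (W : ℝ≥0∞) (_ : ∀ h ∈ Ioc 0 (1 / (n : ℝ)),
        eLpNorm ((fwdDiff h)^[r] F) p (volume.restrict (Icc 0 (1 - r * h))) ≤ W),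
      ∃ P : Polynomial ℝ, P.degree < n ∧
        eLpNorm (fun x => F x - P.eval x) p (volume.restrict (Icc 0 1)) ≤ C * W := by
  obtain ⟨C₁, hC₁0, hC₁⟩ := exists_iteratedIntegral_approx hr
  obtain ⟨C₂, hC₂0, hC₂⟩ := IsIteratedIntegral.exists_polynomial_approx r
  refine ⟨2 * r + Real.toNNReal (C₂ * C₁), fun p hp F hF hFi n hn W hW => ?_⟩
  obtain ⟨φ, g, hφg, hFg, hφ⟩ := hC₁ p hp F hF hFi n hn W hW
  obtain ⟨P, hPdeg, hP⟩ := hC₂ p hp φ g hφg n hn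
  refine ⟨P, hPdeg, ?_⟩
  have hg := hφg.locallyIntegrable.aestronglyMeasurable
  have hn0 : (0 : ℝ) < n := by exact_mod_cast hr.trans hn
  have hfun : (fun x => F x - P.eval x) = (fun x => F x - g x) + fun x => g x - P.eval x := by
    funext x
    simp
  rw [hfun]
  refine (eLpNorm_add_le (hF.aestronglyMeasurable.sub hg.restrict)
    (hg.restrict.sub P.continuous.aestronglyMeasurable) hp).trans ?_
  calc _ ≤ 2 * r * W + ENNReal.ofReal (C₂ / n ^ r) * (ENNReal.ofReal (C₁ * n ^ r) * W) :=
        add_le_add hFg (hP.trans (by gcongr))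
    _ = _ := by
        rw [← mul_assoc, ← ENNReal.ofReal_mul (by positivity)]
        have : C₂ / n ^ r * (C₁ * n ^ r) = C₂ * C₁ := by field_simp
        rw [this, ← add_mul]
        push_cast
        rfl

/-! ### Networks approximate polynomials -/

theorem NearlyExponential.exists_ne_zero {σ : ℝ → ℝ} (hσ : NearlyExponential σ) :
    ∃ c, σ c ≠ 0 := by
  by_contra! h
  obtain ⟨a, b, c, d, hd⟩ := hσ (1 / 4) (by norm_num)
  have h1 := abs_lt.1 (hd 0 le_rfl)
  have h2 := abs_lt.1 (hd (-1) (by norm_num))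
  rw [h, mul_zero, zero_add, Real.exp_zero] at h1
  rw [h, mul_zero, zero_add, Real.exp_neg] at h2
  have h3 : (Real.exp 1)⁻¹ ≤ 2⁻¹ := inv_anti₀ two_pos (by linarith [Real.add_one_le_exp (1 : ℝ)])
  linarith

/-- Exponential sums `∑ q_k e^{k t x}` with `t > 0` are uniformly approximated by networks: the
terms with `k ≥ 1` by one neuron each, up to constants, and all constants by a neuron that takes
the place of `k = 0`. -/
theorem NearlyExponential.exists_network_near_exponentialSum {σ : ℝ → ℝ}
    (hσ : NearlyExponential σ) {t : ℝ} (ht : 0 < t) (N : ℕ) (q : ℕ → ℝ) {ε : ℝ} (hε : 0 < ε) :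
    ∃ g ∈ networks (N + 1) σ, ∀ x ∈ Icc (0 : ℝ) 1,
      |∑ k ∈ Finset.range (N + 1), q k * Real.exp (k * t * x) - g x| ≤ ε := by
  obtain ⟨c₀, hc₀⟩ := hσ.exists_ne_zero
  set w : ℕ → ℝ := fun k => q (k + 1) * Real.exp ((k + 1 : ℕ) * t) with hw
  set M := ∑ k ∈ Finset.range N, |w k| with hM
  have hM0 : 0 ≤ M := Finset.sum_nonneg fun _ _ => abs_nonneg _
  obtain ⟨a, b, c, d, hd⟩ := hσ (ε / (M + 1)) (by positivity)
  set κ := q 0 + ∑ k ∈ Finset.range N, w k * d with hκ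
  refine ⟨_, ⟨Fin.cons (κ / σ c₀) fun k => w k * a, Fin.cons 0 fun k => b * ((k + 1 : ℕ) * t),
    Fin.cons c₀ fun k => c - b * ((k + 1 : ℕ) * t), rfl⟩, fun x hx => ?_⟩
  have hdiff : ∑ k ∈ Finset.range (N + 1), q k * Real.exp (k * t * x)
      - ∑ k : Fin (N + 1), (Fin.cons (κ / σ c₀) fun k : Fin N => w k * a : Fin (N + 1) → ℝ) k
          * σ ((Fin.cons 0 fun k : Fin N => b * ((k + 1 : ℕ) * t) : Fin (N + 1) → ℝ) k * x
            + (Fin.cons c₀ fun k : Fin N => c - b * ((k + 1 : ℕ) * t) : Fin (N + 1) → ℝ) k)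
      = -∑ k ∈ Finset.range N, w k *
          (a * σ (b * ((k + 1 : ℕ) * t * (x - 1)) + c) + d
            - Real.exp ((k + 1 : ℕ) * t * (x - 1))) := by
    rw [Fin.sum_univ_succ, Finset.sum_range_succ']
    simp only [Fin.cons_zero, Fin.cons_succ, zero_mul, zero_add, Nat.cast_zero, Real.exp_zero,
      mul_one, div_mul_cancel₀ _ hc₀]
    rw [hκ, Finset.sum_range, Finset.sum_range, Finset.sum_range]
    have : ∀ k : Fin N, w k * (a * σ (b * ((k + 1 : ℕ) * t * (x - 1)) + c) + d
          - Real.exp ((k + 1 : ℕ) * t * (x - 1)))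
        = w k * a * σ (b * ((k + 1 : ℕ) * t) * x + (c - b * ((k + 1 : ℕ) * t))) + w k * d
          - q (k + 1) * Real.exp ((k + 1 : ℕ) * t * x) := by
      intro k
      have e1 : b * ((k + 1 : ℕ) * t * (x - 1)) + c
          = b * ((k + 1 : ℕ) * t) * x + (c - b * ((k + 1 : ℕ) * t)) := by ring
      have e2 : q (k + 1) * Real.exp ((k + 1 : ℕ) * t * x)
          = w k * Real.exp ((k + 1 : ℕ) * t * (x - 1)) := by
        simp only [hw]
        rw [mul_assoc (q _), ← Real.exp_add]
        congr 2
        ring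
      rw [e1, e2]
      ring
    simp only [this]
    rw [Finset.sum_sub_distrib, Finset.sum_add_distrib]
    ring
  rw [hdiff, abs_neg]
  refine (Finset.abs_sum_le_sum_abs _ _).trans ?_
  calc _ ≤ ∑ k ∈ Finset.range N, |w k| * (ε / (M + 1)) := by
        refine Finset.sum_le_sum fun k _ => ?_
        rw [abs_mul]
        gcongr
        refine (hd _ ?_).le
        exact mul_nonpos_of_nonneg_of_nonpos (by positivity) (by linarith [hx.2])
    _ = M / (M + 1) * ε := by rw [← Finset.sum_mul]; ring
    _ ≤ ε := by
        refine mul_le_of_le_one_left hε.le ?_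
        rw [div_le_one (by positivity)]
        linarith

/-- Polynomials are uniformly approximated by exponential sums of the same length, since
`(e^{tx} - 1) / t → x` as `t → 0`. -/
theorem exists_exponentialSum_near_polynomial (P : Polynomial ℝ) {ε : ℝ} (hε : 0 < ε) :
    ∃ t : ℝ, 0 < t ∧ ∃ R : Polynomial ℝ, R.natDegree ≤ P.natDegree ∧
      ∀ x ∈ Icc (0 : ℝ) 1, |P.eval x - R.eval (Real.exp (t * x))| ≤ ε := by
  have huc : UniformContinuousOn (fun y => P.eval y) (Icc (-1 : ℝ) 2) :=
    isCompact_Icc.uniformContinuousOn_of_continuous P.continuous.continuousOn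
  obtain ⟨δ, hδ, hP⟩ := Metric.uniformContinuousOn_iff_le.1 huc ε hε
  set t := min 1 δ with ht
  have ht0 : 0 < t := lt_min one_pos hδ
  have ht1 : t ≤ 1 := min_le_left _ _
  refine ⟨t, ht0, P.comp (Polynomial.C t⁻¹ * (Polynomial.X - Polynomial.C 1)), ?_, ?_⟩
  · refine Polynomial.natDegree_comp_le.trans ?_
    refine mul_le_of_le_one_right (Nat.zero_le _) ?_
    refine (Polynomial.natDegree_C_mul_le _ _).trans ?_
    rw [Polynomial.natDegree_X_sub_C]
  · intro x hx
    set y := t⁻¹ * (Real.exp (t * x) - 1) with hy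
    have htx : 0 ≤ t * x := mul_nonneg ht0.le hx.1
    have htx1 : t * x ≤ t := mul_le_of_le_one_right ht0.le hx.2
    have hxy : |x - y| ≤ t := by
      have h1 := Real.abs_exp_sub_one_sub_id_le (x := t * x) (by rw [abs_of_nonneg htx]; linarith)
      have h2 : x - y = -(t⁻¹ * (Real.exp (t * x) - 1 - t * x)) := by
        rw [hy]; field_simp; ring
      rw [h2, abs_neg, abs_mul, abs_of_pos (inv_pos.2 ht0)]
      calc t⁻¹ * |Real.exp (t * x) - 1 - t * x| ≤ t⁻¹ * (t * x) ^ 2 := by gcongr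
        _ ≤ t⁻¹ * t ^ 2 := by gcongr
        _ = t := by field_simp
    have h3 := abs_le.1 hxy
    have h4 := hP x ⟨by linarith [hx.1], by linarith [hx.2]⟩ y
      ⟨by linarith [hx.1], by linarith [hx.2]⟩
      (by rw [Real.dist_eq]; exact hxy.trans (min_le_right _ _))
    rw [Real.dist_eq] at h4
    simpa [hy] using h4

theorem NearlyExponential.exists_network_near_polynomial {σ : ℝ → ℝ} (hσ : NearlyExponential σ)
    {n : ℕ} {P : Polynomial ℝ} (hn : 1 ≤ n) (hP : P.degree < n) {ε : ℝ} (hε : 0 < ε) :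
    ∃ g ∈ networks n σ, ∀ x ∈ Icc (0 : ℝ) 1, |P.eval x - g x| ≤ ε := by
  obtain ⟨N, rfl⟩ : ∃ N, n = N + 1 := ⟨n - 1, by omega⟩
  have hPdeg : P.natDegree < N + 1 := by
    by_cases h0 : P = 0
    · simp [h0]
    · exact (Polynomial.natDegree_lt_iff_degree_lt h0).2 hP
  obtain ⟨t, ht, R, hRdeg, hR⟩ := exists_exponentialSum_near_polynomial P (half_pos hε)
  obtain ⟨g, hg, hgR⟩ :=
    hσ.exists_network_near_exponentialSum ht N (fun k => R.coeff k) (half_pos hε)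
  refine ⟨g, hg, fun x hx => ?_⟩
  have h1 := hR x hx
  have h2 := hgR x hx
  have h3 : R.eval (Real.exp (t * x))
      = ∑ k ∈ Finset.range (N + 1), R.coeff k * Real.exp (k * t * x) := by
    rw [Polynomial.eval_eq_sum_range' (hRdeg.trans_lt hPdeg)]
    refine Finset.sum_congr rfl fun k _ => ?_
    rw [← Real.exp_nat_mul, mul_assoc]
  rw [← h3] at h2
  calc |P.eval x - g x|
      ≤ |P.eval x - R.eval (Real.exp (t * x))| + |R.eval (Real.exp (t * x)) - g x| :=
        abs_sub_le _ _ _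
    _ ≤ ε := by linarith

/-! ### The norms of `X^p[0, 1]` and the error of best approximation -/

theorem eLpNorm_le_normOn (p : ℝ≥0∞) {s : Set ℝ} (hs : MeasurableSet s) (u : ℝ → ℝ) :
    eLpNorm u p (volume.restrict s) ≤ normOn p s u := by
  rcases eq_or_ne p ∞ with rfl | hp
  · rw [normOn_top, eLpNorm_exponent_top]
    refine eLpNormEssSup_le_of_ae_enorm_bound ?_
    refine (ae_restrict_iff' hs).2 (ae_of_all _ fun x hx => ?_)
    exact le_iSup₂ (f := fun x (_ : x ∈ s) => ‖u x‖ₑ) x hx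
  · rw [normOn, if_neg hp]
    refine le_iInf fun v => le_iInf fun _ => le_iInf fun hle => ?_
    exact eLpNorm_mono_enorm_ae (by simpa using hle)

/-- For continuous functions the essential supremum over `[0, 1]` bounds every value. -/
theorem enorm_le_of_eLpNorm_top_le {u : ℝ → ℝ} (hu : ContinuousOn u (Icc 0 1)) {B : ℝ≥0∞}
    (hB : eLpNorm u ∞ (volume.restrict (Icc 0 1)) ≤ B) {x : ℝ} (hx : x ∈ Icc (0 : ℝ) 1) :
    ‖u x‖ₑ ≤ B := by
  have hae : (fun x => max ‖u x‖ₑ B) =ᵐ[volume.restrict (Icc 0 1)] fun _ => B := by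
    have h := ae_le_eLpNormEssSup (f := u) (μ := volume.restrict (Icc (0 : ℝ) 1))
    filter_upwards [h] with y hy
    rw [eLpNorm_exponent_top] at hB
    exact max_eq_right (hy.trans hB)
  have hc : ContinuousOn (fun x => max ‖u x‖ₑ B) (Icc 0 1) :=
    (continuous_enorm.max continuous_const).comp_continuousOn hu
  have := Measure.eqOn_Icc_of_ae_eq volume zero_ne_one hae hc continuousOn_const hx
  exact max_eq_right_iff.1 this

/-- Replacing a polynomial by a uniformly close function, which need not be measurable, changes the
error in `X^p[0, 1]` by no more than the uniform distance. -/
theorem normOn_sub_le_add {p : ℝ≥0∞} (hp : 1 ≤ p) {f u g : ℝ → ℝ} (hf : MemX p f)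
    (hu : Continuous u) {B : ℝ≥0∞} {ε : ℝ≥0}
    (hB : eLpNorm (fun x => f x - u x) p (volume.restrict (Icc 0 1)) ≤ B)
    (hg : ∀ x ∈ Icc (0 : ℝ) 1, |u x - g x| ≤ ε) :
    normOn p (Icc 0 1) (fun x => f x - g x) ≤ B + ε := by
  have hpt : ∀ x ∈ Icc (0 : ℝ) 1, ‖f x - g x‖ₑ ≤ ‖f x - u x‖ₑ + ε := by
    intro x hx
    have h1 : f x - g x = (f x - u x) + (u x - g x) := by ring
    rw [h1]
    refine (enorm_add_le _ _).trans ?_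
    gcongr
    rw [Real.enorm_eq_ofReal_abs, ← ENNReal.ofReal_coe_nnreal]
    exact ENNReal.ofReal_le_ofReal (hg x hx)
  rcases eq_or_ne p ∞ with rfl | hpt'
  · rw [normOn_top]
    refine iSup₂_le fun x hx => (hpt x hx).trans ?_
    gcongr
    exact enorm_le_of_eLpNorm_top_le ((hf.1 rfl).sub hu.continuousOn) hB hx
  · rw [normOn, if_neg hpt']
    have hm : AEMeasurable (fun x => f x - u x) (volume.restrict (Icc 0 1)) :=
      (hf.2 hpt').1.aemeasurable.sub hu.aemeasurable
    refine (iInf₂_le (fun x => ‖hm.mk _ x‖ₑ + ε) (hm.measurable_mk.enorm.add_const _)).trans ?_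
    refine (iInf_le _ ?_).trans ?_
    · filter_upwards [hm.ae_eq_mk, ae_restrict_mem measurableSet_Icc] with x hx hx1
      rw [← hx]
      exact hpt x hx1
    · refine (eLpNorm_add_le hm.measurable_mk.enorm.aestronglyMeasurable
        aestronglyMeasurable_const hp).trans ?_
      gcongr
      · refine le_trans (le_of_eq (eLpNorm_congr_enorm_ae ?_)) hB
        filter_upwards [hm.ae_eq_mk] with x hx
        rw [enorm_eq_self, hx]
      · rw [eLpNorm_const _ (zero_lt_one.trans_le hp).ne' (by simp)]
        simp

/-- A function in `X^p[0, 1]` has a Borel representative that is integrable on the whole line. -/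
theorem MemX.exists_measurable_representative {p : ℝ≥0∞} (hp : 1 ≤ p) {f : ℝ → ℝ}
    (hf : MemX p f) : ∃ F : ℝ → ℝ, Measurable F ∧ Integrable F ∧
      f =ᵐ[volume.restrict (Icc 0 1)] F := by
  have hi : IntegrableOn f (Icc 0 1) := by
    rcases eq_or_ne p ∞ with rfl | hpt
    · exact (hf.1 rfl).integrableOn_Icc
    · exact (hf.2 hpt).integrable hp
  refine ⟨(Icc 0 1).indicator (hi.1.mk f),
    hi.1.stronglyMeasurable_mk.measurable.indicator measurableSet_Icc, ?_, ?_⟩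
  · rw [integrable_indicator_iff measurableSet_Icc]
    exact hi.congr hi.1.ae_eq_mk
  · filter_upwards [hi.1.ae_eq_mk, ae_restrict_mem measurableSet_Icc] with x hx hx1
    rw [indicator_of_mem hx1, hx]

theorem fwdDiff_iterate_ae_eq {f F : ℝ → ℝ} (h : f =ᵐ[volume.restrict (Icc 0 1)] F) (r : ℕ) {t : ℝ}
    (ht : 0 ≤ t) : (fwdDiff t)^[r] f =ᵐ[volume.restrict (Icc 0 (1 - r * t))] (fwdDiff t)^[r] F := by
  have h0 : ∀ᵐ x, x ∈ Icc (0 : ℝ) 1 → f x = F x := (ae_restrict_iff' measurableSet_Icc).1 h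
  have h1 : ∀ᵐ x, ∀ j : ℕ, x + j * t ∈ Icc (0 : ℝ) 1 → f (x + j * t) = F (x + j * t) :=
    ae_all_iff.2 fun j => (measurePreserving_add_right volume (j * t)).quasiMeasurePreserving.ae h0
  refine (ae_restrict_iff' measurableSet_Icc).2 ?_
  filter_upwards [h1] with x hx hx1
  rw [fwdDiff_iterate_eq_sum, fwdDiff_iterate_eq_sum]
  refine Finset.sum_congr rfl fun j hj => ?_
  rw [hx j]
  have hjr : (j : ℝ) ≤ r := by exact_mod_cast Nat.lt_succ_iff.1 (Finset.mem_range.1 hj)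
  have := mul_le_mul_of_nonneg_right hjr ht
  have : 0 ≤ j * t := by positivity
  exact ⟨by linarith [hx1.1], by linarith [hx1.2]⟩

theorem theorem1 (r : ℕ) (hr : 1 ≤ r) :
    ∃ C : ℝ≥0, ∀ (p : ℝ≥0∞) (_ : 1 ≤ p) (σ : ℝ → ℝ) (_ : NearlyExponential σ)
      (f : ℝ → ℝ) (_ : MemX p f) (n : ℕ) (_ : max r 2 ≤ n),
      bestApproxError (networks n σ) f p ≤ C * modulusOfSmoothness r f (1 / (n : ℝ)) p := by
  obtain ⟨C, hC⟩ := exists_polynomial_jackson hr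
  refine ⟨C, fun p hp σ hσ f hf n hn => ?_⟩
  have hrn : r ≤ n := (le_max_left _ _).trans hn
  obtain ⟨F, hFm, hFi, hfF⟩ := hf.exists_measurable_representative hp
  obtain ⟨P, hPdeg, hP⟩ := hC p hp F hFm hFi n hrn (modulusOfSmoothness r f (1 / (n : ℝ)) p) (by
    intro h hh
    rw [← eLpNorm_congr_ae (fwdDiff_iterate_ae_eq hfF r hh.1.le)]
    refine (eLpNorm_le_normOn p measurableSet_Icc _).trans ?_
    exact le_iSup₂ (f := fun (h : ℝ) (_ : h ∈ Ioc 0 (1 / (n : ℝ))) =>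
      normOn p (Icc 0 (1 - r * h)) ((fwdDiff h)^[r] f)) h hh)
  have hP' : eLpNorm (fun x => f x - P.eval x) p (volume.restrict (Icc 0 1))
      ≤ C * modulusOfSmoothness r f (1 / (n : ℝ)) p := by
    refine le_trans (le_of_eq (eLpNorm_congr_ae ?_)) hP
    filter_upwards [hfF] with x hx
    rw [hx]
  refine ENNReal.le_of_forall_pos_le_add fun ε hε _ => ?_
  obtain ⟨g, hg, hPg⟩ := hσ.exists_network_near_polynomial (hr.trans hrn) hPdeg
    (NNReal.coe_pos.2 hε)
  exact (iInf₂_le g hg).trans (normOn_sub_le_add hp hf P.continuous hP' hPg)
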